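/- Let $M=J^1(\mathbb R^2,\mathbb R)$ with standard coordinates $x,y,z,p,q$. A hyperbolic Monge--Amp\`ere equation $N(z_{xx}z_{yy}-z_{xy}^2)+Az_{xx}+Bz_{xy}+Cz_{yy}+D=0$, with coefficients functions on $M$ and $\Delta=B^2-4AC+4ND>0$, is a section of the bundle $\pi$ over $M$ whose fibre is $\{[N:A:B:C:D]\in\mathbb{RP}^4:\Delta>0\}$. On the open dense part $N\neq0$ use the fibre coordinates (normalizing $N=1$) $$u^1=-C,\quad u^2=\tfrac12(B-\sqrt\Delta),\quad u^3=\tfrac12(B+\sqrt\Delta),\quad u^4=-A,$$ which range over all $u\in\mathbb R^4$ with $u^2<u^3$. Thus, on the open dense part $N\ne0$, $J^3\pi$ has the standard coordinates $(x,y,z,p,q,u^i_\sigma)$, $|\sigma|\le3$, subject only to $u^2<u^3$; in the following $J^3\pi$ denotes this part. For an equation given by $u=(u^1,\dots,u^4)$ put $$X_1=\partial_x+p\,\partial_z+u^1\partial_p+u^2\partial_q,\quad X_2=\partial_y+q\,\partial_z+u^3\partial_p+u^4\partial_q,$$ $$X_3=\partial_x+p\,\partial_z+u^1\partial_p+u^3\partial_q,\quad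 X_4=\partial_y+q\,\partial_z+u^2\partial_p+u^4\partial_q,$$ and let $X_5$ be the generator of $\langle X_1,X_2,[X_1,X_2]\rangle\cap\langle X_3,X_4,[X_3,X_4]\rangle$ of the form $X_5=\lambda^1X_1+\lambda^2X_2+[X_1,X_2]$. Define $b^i_{jk}$ by $[X_j,X_k]=\sum_i b^i_{jk}X_i$ and put $$\Lambda_1=b^2_{35}b^1_{45}-b^1_{35}b^2_{45},\qquad \Lambda_2=b^4_{15}b^3_{25}-b^3_{15}b^4_{25},$$ $$\Lambda_{12}=b^3_{15}b^1_{35}+b^4_{15}b^1_{45}+b^3_{25}b^2_{35}+b^4_{25}b^2_{45},\qquad \mathcal B=b^1_{15}+b^2_{25}+b^3_{35}+b^4_{45},$$ $$I^1_\sigma=\frac{X_5(\Lambda_\sigma)+\Lambda_\sigma \mathcal B}{|\Lambda_1|^{3/2}}\quad(\sigma=1,2,12),$$ $$I^1=\frac{\Lambda_{12}}{\Lambda_1},\quad I^2=\frac{\Lambda_{12}}{\Lambda_2},\quad I^3=(I^1_1)^2,\quad I^4=(I^1_2)^2,\quad I^5=(I^1_{12})^2 .$$ Theorem. The values of $I^1,\dots,I^5$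 on an equation at a point depend only on the $3$-jet of the equation there, and those of $I^1,I^2$ only on the $2$-jet. The set of generic jets $\{\Lambda_1\ne0,\ \Lambda_2\neq0\}$ is open and dense in $J^3\pi$, and $I^1,\dots,I^5$ are smooth functions on it. They are functionally independent on $J^3\pi$: there is an open set $W$ of generic jets, dense in $J^3\pi$, such that the differentials $dI^1,\dots,dI^5$ are linearly independent at every point of $W$. -/

import Mathlib

open scoped ContDiff

namespace MongeAmpere

noncomputable section

/-- The contact manifold `M = J¹τ` of first jets of functions `z(x, y)`, in its standard global
coordinates: the entries `0, 1, 2, 3, 4` of a point are `x, y, z, p, q`. -/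
abbrev M := Fin 5 → ℝ

/-! ### Hyperbolic Monge-Ampere equations and the fibre coordinates `u¹, …, u⁴`

An equation `N (z_xx z_yy - z_xy ^ 2) + A z_xx + B z_xy + C z_yy + D = 0` is, at a point of `M`,
a nonzero quintuple `c = (N, A, B, C, D)` up to a nonzero factor. -/

/-- `Δ = B² - 4 A C + 4 N D`; the equation is hyperbolic when `Δ > 0`. -/
def discr (c : Fin 5 → ℝ) : ℝ := c 2 ^ 2 - 4 * c 1 * c 3 + 4 * c 0 * c 4

/-- The coordinates `(u¹, u², u³, u⁴)` of the hyperbolic equation `[N : A : B : C : D]`, `N ≠ 0`: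
with `pⁱ` the affine coordinates (`p⁰ = 1`), they are
`(-p³, (p² - √Δ) / 2, (p² + √Δ) / 2, -p¹)`. -/
def fibreCoord (c : Fin 5 → ℝ) : Fin 4 → ℝ :=
  let P : Fin 5 → ℝ := fun i => c i / c 0
  ![-P 3, (P 2 - √(discr P)) / 2, (P 2 + √(discr P)) / 2, -P 1]

/-- The equation with `N = 1` that has the given fibre coordinates. -/
def coefOf (u : Fin 4 → ℝ) : Fin 5 → ℝ := ![1, -u 3, u 1 + u 2, -u 0, u 0 * u 3 - u 1 * u 2]

theorem discr_coefOf (u : Fin 4 → ℝ) : discr (coefOf u) = (u 2 - u 1) ^ 2 := by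
  simp [discr, coefOf]; ring

/-- Every `u` with `u² < u³` is the coordinate vector of a hyperbolic equation with `N ≠ 0`. -/
theorem fibreCoord_coefOf (u : Fin 4 → ℝ) (hu : u 1 < u 2) : fibreCoord (coefOf u) = u := by
  have h0 : (fun i => coefOf u i / coefOf u 0) = coefOf u := by
    funext i; simp [coefOf]
  have h : √(discr (coefOf u)) = u 2 - u 1 := by
    rw [discr_coefOf, Real.sqrt_sq (by linarith)]
  funext i
  simp only [fibreCoord, h0, h]
  fin_cases i <;> simp [coefOf] <;> ring

/-- Every hyperbolic equation with `N ≠ 0` has coordinates with `u² < u³`, and they determine it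
up to a factor. -/
theorem coefOf_fibreCoord (c : Fin 5 → ℝ) (h0 : c 0 ≠ 0) (hc : 0 < discr c) :
    fibreCoord c 1 < fibreCoord c 2 ∧ c = c 0 • coefOf (fibreCoord c) := by
  have hP : discr (fun i => c i / c 0) = discr c / c 0 ^ 2 := by
    simp only [discr]; field_simp
  have hpos : 0 < discr (fun i => c i / c 0) := by rw [hP]; positivity
  have hs : 0 < √(discr (fun i => c i / c 0)) := Real.sqrt_pos.2 hpos
  have hsq := Real.mul_self_sqrt hpos.le
  have h1 : fibreCoord c 1 < fibreCoord c 2 := by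
    simp only [fibreCoord, Matrix.cons_val]
    linarith
  refine ⟨h1, ?_⟩
  funext i
  fin_cases i
  · simp [coefOf]
  · simp [coefOf, fibreCoord]; field_simp
  · simp [coefOf, fibreCoord]; field_simp; ring
  · simp [coefOf, fibreCoord]; field_simp
  · have e : c 3 / c 0 * (c 1 / c 0) - (c 2 / c 0 - √(discr fun i => c i / c 0)) / 2
        * ((c 2 / c 0 + √(discr fun i => c i / c 0)) / 2) = c 4 / c 0 := by
      have h2 : discr (fun i => c i / c 0)
          = (c 2 / c 0) ^ 2 - 4 * (c 1 / c 0) * (c 3 / c 0) + 4 * (c 4 / c 0) := by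
        simp only [discr]; rw [div_self h0]; ring
      rw [h2] at hsq ⊢
      linear_combination hsq / 4
    simp [coefOf, fibreCoord]
    rw [e]; field_simp

/-! ### The frame of an equation

A (local) section of the bundle of hyperbolic equations with `N ≠ 0` is a map `u : M → ℝ⁴` with
`u² < u³`; the entries `0, 1, 2, 3` of `u y` are `u¹, u², u³, u⁴`. -/

/-- The derivative `X(f)` of a function along a vector field. -/
def along (X : M → M) (f : M → ℝ) : M → ℝ := fun y => fderiv ℝ f y (X y)

/-- `X₁ = ∂x + p ∂z + u¹ ∂p + u² ∂q`. -/
def X1 (u : M → Fin 4 → ℝ) : M → M := fun y => ![1, 0, y 3, u y 0, u y 1]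

/-- `X₂ = ∂y + q ∂z + u³ ∂p + u⁴ ∂q`; the fields `X₁, X₂` span the first distribution. -/
def X2 (u : M → Fin 4 → ℝ) : M → M := fun y => ![0, 1, y 4, u y 2, u y 3]

/-- `X₃ = ∂x + p ∂z + u¹ ∂p + u³ ∂q`. -/
def X3 (u : M → Fin 4 → ℝ) : M → M := fun y => ![1, 0, y 3, u y 0, u y 2]

/-- `X₄ = ∂y + q ∂z + u² ∂p + u⁴ ∂q`; the fields `X₃, X₄` span the second distribution. -/
def X4 (u : M → Fin 4 → ℝ) : M → M := fun y => ![0, 1, y 4, u y 1, u y 3]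

/-- The coefficient `λ¹` of `X₅`. -/
def lam1 (u : M → Fin 4 → ℝ) : M → ℝ := fun y =>
  (along (X2 u) (fun y => u y 1) y + along (X4 u) (fun y => u y 2) y
    - along (X1 u) (fun y => u y 3) y - along (X3 u) (fun y => u y 3) y) / (u y 1 - u y 2)

/-- The coefficient `λ²` of `X₅`. -/
def lam2 (u : M → Fin 4 → ℝ) : M → ℝ := fun y =>
  (along (X1 u) (fun y => u y 2) y + along (X3 u) (fun y => u y 1) y
    - along (X2 u) (fun y => u y 0) y - along (X4 u) (fun y => u y 0) y) / (u y 1 - u y 2)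

/-- `X₅ = λ¹ X₁ + λ² X₂ + [X₁, X₂]`, the generator of
`⟨X₁, X₂, [X₁, X₂]⟩ ∩ ⟨X₃, X₄, [X₃, X₄]⟩` normalized by the coefficient `1` at `[X₁, X₂]`
(see `X5_eq` for the second membership). -/
def X5 (u : M → Fin 4 → ℝ) : M → M := fun y =>
  lam1 u y • X1 u y + lam2 u y • X2 u y + VectorField.lieBracket ℝ (X1 u) (X2 u) y

theorem fderiv_vec {a b : ℝ} {g : Fin 3 → M → ℝ} {y : M}
    (hg : ∀ i, DifferentiableAt ℝ (g i) y) (v : M) :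
    fderiv ℝ (fun y => (![a, b, g 0 y, g 1 y, g 2 y] : M)) y v
      = ![0, 0, fderiv ℝ (g 0) y v, fderiv ℝ (g 1) y v, fderiv ℝ (g 2) y v] := by
  have : HasFDerivAt (fun y => (![a, b, g 0 y, g 1 y, g 2 y] : M))
      (ContinuousLinearMap.pi ![0, 0, fderiv ℝ (g 0) y, fderiv ℝ (g 1) y, fderiv ℝ (g 2) y]) y := by
    rw [hasFDerivAt_pi']
    intro i
    fin_cases i
    · exact hasFDerivAt_const a y
    · exact hasFDerivAt_const b y
    · exact (hg 0).hasFDerivAt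
    · exact (hg 1).hasFDerivAt
    · exact (hg 2).hasFDerivAt
  rw [this.fderiv]
  funext i
  fin_cases i <;> simp

theorem fderiv_frame {g h : M → ℝ} {y : M} (a b : ℝ) (j : Fin 5)
    (hg : DifferentiableAt ℝ g y) (hh : DifferentiableAt ℝ h y) (v : M) :
    fderiv ℝ (fun y => (![a, b, y j, g y, h y] : M)) y v
      = ![0, 0, v j, fderiv ℝ g y v, fderiv ℝ h y v] := by
  have hj : DifferentiableAt ℝ (fun y : M => y j) y := differentiableAt_apply j y
  have e : fderiv ℝ (fun y : M => y j) y v = v j := by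
    rw [(hasFDerivAt_apply j y).fderiv]; rfl
  have := fderiv_vec (a := a) (b := b) (g := ![fun y => y j, g, h]) (y := y)
    (by intro i; fin_cases i; exacts [hj, hg, hh]) v
  simpa [e] using this

/-- `X₅` also lies in `⟨X₃, X₄, [X₃, X₄]⟩`. -/
theorem X5_eq (u : M → Fin 4 → ℝ) (y : M) (hu : DifferentiableAt ℝ u y) (h : u y 1 < u y 2) :
    X5 u y = lam1 u y • X3 u y + lam2 u y • X4 u y
      - VectorField.lieBracket ℝ (X3 u) (X4 u) y := by
  have hd : ∀ i, DifferentiableAt ℝ (fun y => u y i) y := fun i => differentiableAt_pi.1 hu i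
  have hne : u y 1 - u y 2 ≠ 0 := by linarith
  have e1 : lam1 u y * (u y 1 - u y 2) = _ := div_mul_cancel₀ _ hne
  have e2 : lam2 u y * (u y 1 - u y 2) = _ := div_mul_cancel₀ _ hne
  simp only [along] at e1 e2
  have f1 := fun v => fderiv_frame 1 0 3 (hd 0) (hd 1) v
  have f2 := fun v => fderiv_frame 0 1 4 (hd 2) (hd 3) v
  have f3 := fun v => fderiv_frame 1 0 3 (hd 0) (hd 2) v
  have f4 := fun v => fderiv_frame 0 1 4 (hd 1) (hd 3) v
  funext i
  simp only [X5, VectorField.lieBracket, Pi.add_apply, Pi.sub_apply, Pi.smul_apply]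
  simp only [show fderiv ℝ (X1 u) y = fderiv ℝ (fun y => (![1, 0, y 3, u y 0, u y 1] : M)) y
      from rfl,
    show fderiv ℝ (X2 u) y = fderiv ℝ (fun y => (![0, 1, y 4, u y 2, u y 3] : M)) y from rfl,
    show fderiv ℝ (X3 u) y = fderiv ℝ (fun y => (![1, 0, y 3, u y 0, u y 2] : M)) y from rfl,
    show fderiv ℝ (X4 u) y = fderiv ℝ (fun y => (![0, 1, y 4, u y 1, u y 3] : M)) y from rfl,
    f1, f2, f3, f4]
  fin_cases i
  · simp [X1, X2, X3, X4]
  · simp [X1, X2, X3, X4]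
  · simp [X1, X2, X3, X4]; ring
  · simp only [X1, X2, X3, X4, Fin.reduceFinMk, Matrix.cons_val, smul_eq_mul] at e2 ⊢
    linear_combination -e2
  · simp only [X1, X2, X3, X4, Fin.reduceFinMk, Matrix.cons_val, smul_eq_mul] at e1 ⊢
    linear_combination e1

/-- The frame `X₁, …, X₅` of `M` (entry `i` is `X_{i+1}`). -/
def frame (u : M → Fin 4 → ℝ) : Fin 5 → M → M := ![X1 u, X2 u, X3 u, X4 u, X5 u]

/-- The matrix whose columns are the vectors `X₁, …, X₅` at the point `y`. -/
def frameMatrix (u : M → Fin 4 → ℝ) (y : M) : Matrix (Fin 5) (Fin 5) ℝ :=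
  Matrix.of fun i j => frame u j y i

/-- The structure functions: `[X_j, X_k] = ∑ i, bⁱ_{jk} X_i` (zero-based indices). -/
def b (u : M → Fin 4 → ℝ) (i j k : Fin 5) : M → ℝ := fun y =>
  ((frameMatrix u y)⁻¹.mulVec (VectorField.lieBracket ℝ (frame u j) (frame u k) y)) i

/-- `X₁, …, X₅` is a frame wherever `u` is hyperbolic. -/
theorem det_frameMatrix (u : M → Fin 4 → ℝ) (y : M) (hu : DifferentiableAt ℝ u y) :
    (frameMatrix u y).det = (u y 1 - u y 2) ^ 3 := by
  have hd : ∀ i, DifferentiableAt ℝ (fun y => u y i) y := fun i => differentiableAt_pi.1 hu i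
  have f1 := fun v => fderiv_frame 1 0 3 (hd 0) (hd 1) v
  have f2 := fun v => fderiv_frame 0 1 4 (hd 2) (hd 3) v
  have k0 : VectorField.lieBracket ℝ (X1 u) (X2 u) y 0 = 0 := by
    simp only [VectorField.lieBracket, Pi.sub_apply,
      show fderiv ℝ (X1 u) y = fderiv ℝ (fun y => (![1, 0, y 3, u y 0, u y 1] : M)) y from rfl,
      show fderiv ℝ (X2 u) y = fderiv ℝ (fun y => (![0, 1, y 4, u y 2, u y 3] : M)) y from rfl,
      f1, f2]
    simp
  have k1 : VectorField.lieBracket ℝ (X1 u) (X2 u) y 1 = 0 := by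
    simp only [VectorField.lieBracket, Pi.sub_apply,
      show fderiv ℝ (X1 u) y = fderiv ℝ (fun y => (![1, 0, y 3, u y 0, u y 1] : M)) y from rfl,
      show fderiv ℝ (X2 u) y = fderiv ℝ (fun y => (![0, 1, y 4, u y 2, u y 3] : M)) y from rfl,
      f1, f2]
    simp
  have k2 : VectorField.lieBracket ℝ (X1 u) (X2 u) y 2 = u y 1 - u y 2 := by
    simp only [VectorField.lieBracket, Pi.sub_apply,
      show fderiv ℝ (X1 u) y = fderiv ℝ (fun y => (![1, 0, y 3, u y 0, u y 1] : M)) y from rfl,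
      show fderiv ℝ (X2 u) y = fderiv ℝ (fun y => (![0, 1, y 4, u y 2, u y 3] : M)) y from rfl,
      f1, f2]
    simp [X1, X2]
  generalize hm : frameMatrix u y = m
  have hm' : m = Matrix.of ![
      ![1, 0, 1, 0, lam1 u y],
      ![0, 1, 0, 1, lam2 u y],
      ![y 3, y 4, y 3, y 4, lam1 u y * y 3 + lam2 u y * y 4 + (u y 1 - u y 2)],
      ![u y 0, u y 2, u y 0, u y 1, X5 u y 3],
      ![u y 1, u y 3, u y 2, u y 3, X5 u y 4]] := by
    rw [← hm]
    ext i j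
    fin_cases i <;> fin_cases j <;>
      simp [frameMatrix, frame, X1, X2, X3, X4, X5] <;>
      first | exact k0 | exact k1 | exact k2 | rfl
  rw [hm']
  simp [Matrix.det_succ_row_zero, Fin.sum_univ_succ, Fin.succAbove]
  ring

theorem sum_b_smul (u : M → Fin 4 → ℝ) (y : M) (hu : DifferentiableAt ℝ u y)
    (h : u y 1 < u y 2) (j k : Fin 5) :
    VectorField.lieBracket ℝ (frame u j) (frame u k) y = ∑ i, b u i j k y • frame u i y := by
  have hdet : IsUnit (frameMatrix u y).det := by
    rw [det_frameMatrix u y hu, isUnit_iff_ne_zero]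
    exact pow_ne_zero _ (by linarith)
  have := congrArg (fun m => m.mulVec (VectorField.lieBracket ℝ (frame u j) (frame u k) y))
    (Matrix.mul_nonsing_inv _ hdet)
  simp only [← Matrix.mulVec_mulVec, Matrix.one_mulVec] at this
  conv_lhs => rw [← this]
  funext i
  simp [Matrix.mulVec, dotProduct, b, frameMatrix, mul_comm]

/-! ### The invariants of an equation -/

/-- `Λ₁ = b²₃₅ b¹₄₅ - b¹₃₅ b²₄₅`. -/
def Lam1 (u : M → Fin 4 → ℝ) : M → ℝ := fun y =>
  b u 1 2 4 y * b u 0 3 4 y - b u 0 2 4 y * b u 1 3 4 y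

/-- `Λ₂ = b⁴₁₅ b³₂₅ - b³₁₅ b⁴₂₅`. -/
def Lam2 (u : M → Fin 4 → ℝ) : M → ℝ := fun y =>
  b u 3 0 4 y * b u 2 1 4 y - b u 2 0 4 y * b u 3 1 4 y

/-- `Λ₁₂ = b³₁₅ b¹₃₅ + b⁴₁₅ b¹₄₅ + b³₂₅ b²₃₅ + b⁴₂₅ b²₄₅`. -/
def Lam12 (u : M → Fin 4 → ℝ) : M → ℝ := fun y =>
  b u 2 0 4 y * b u 0 2 4 y + b u 3 0 4 y * b u 0 3 4 y
    + b u 2 1 4 y * b u 1 2 4 y + b u 3 1 4 y * b u 1 3 4 y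

/-- `B = b¹₁₅ + b²₂₅ + b³₃₅ + b⁴₄₅`. -/
def Bsum (u : M → Fin 4 → ℝ) : M → ℝ := fun y =>
  b u 0 0 4 y + b u 1 1 4 y + b u 2 2 4 y + b u 3 3 4 y

/-- `I¹_σ = (X₅(Λ_σ) + Λ_σ B) / |Λ₁| ^ (3 / 2)`, where `L` is `Λ_σ`. -/
def almostInv (u : M → Fin 4 → ℝ) (L : M → ℝ) : M → ℝ := fun y =>
  (along (X5 u) L y + L y * Bsum u y) / |Lam1 u y| ^ (3 / 2 : ℝ)

/-- The values `I¹, …, I⁵` on the equation `u`, as functions on `M`: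
`Λ₁₂ / Λ₁`, `Λ₁₂ / Λ₂`, `(I¹_1)²`, `(I¹_2)²`, `(I¹_12)²`. -/
def invOfEq (u : M → Fin 4 → ℝ) : Fin 5 → M → ℝ :=
  ![fun y => Lam12 u y / Lam1 u y,
    fun y => Lam12 u y / Lam2 u y,
    fun y => almostInv u (Lam1 u) y ^ 2,
    fun y => almostInv u (Lam2 u) y ^ 2,
    fun y => almostInv u (Lam12 u) y ^ 2]

/-! ### The jet space `J³π` -/

/-- Multi-indices `σ = (σ₁, …, σ₅)` with `|σ| ≤ 3`. -/
abbrev MultiIdx := {σ : Fin 5 → Fin 4 // ∑ j, (σ j : ℕ) ≤ 3}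

/-- The order `|σ|`. -/
def MultiIdx.order (σ : MultiIdx) : ℕ := ∑ j, (σ.1 j : ℕ)

/-- The standard jet coordinates `(x, y, z, p, q, uⁱ_σ)`, `|σ| ≤ 3`. -/
abbrev JetCoord := M × (MultiIdx → Fin 4 → ℝ)

/-- The multi-index `0`. -/
def MultiIdx.zero : MultiIdx := ⟨fun _ => 0, by simp⟩

/-- The jet space `J³π` of the bundle `π` of hyperbolic equations, in its standard coordinates:
all `(x, y, z, p, q, uⁱ_σ)` with `u² < u³`. -/
def J3 : Set JetCoord := {θ | θ.2 MultiIdx.zero 1 < θ.2 MultiIdx.zero 2}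

/-- The partial derivative with respect to the `j`-th coordinate of `M`. -/
def pderiv (j : Fin 5) (f : M → ℝ) : M → ℝ := fun y => fderiv ℝ f y (Pi.single j 1)

/-- The iterated partial derivative `∂^σ f`. -/
def multiDeriv (σ : MultiIdx) (f : M → ℝ) : M → ℝ :=
  (pderiv 0)^[σ.1 0] ((pderiv 1)^[σ.1 1] ((pderiv 2)^[σ.1 2]
    ((pderiv 3)^[σ.1 3] ((pderiv 4)^[σ.1 4] f))))

/-- The 3-jet of the section `u` at the point `x`. -/
def jet3 (u : M → Fin 4 → ℝ) (x : M) : JetCoord :=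
  (x, fun σ i => multiDeriv σ (fun y => u y i) x)

/-- The polynomial section of degree at most `3` whose 3-jet at the base point `θ.1` is `θ`. -/
def taylor (θ : JetCoord) : M → Fin 4 → ℝ := fun y i =>
  ∑ σ : MultiIdx, θ.2 σ i * ∏ j, (y j - θ.1 j) ^ (σ.1 j : ℕ) / (Nat.factorial (σ.1 j) : ℝ)

/-- The functions `I¹, …, I⁵` on `J³π`: the value at the 3-jet of a section at a point is the
value of the invariant of that section at the point (the choice of the section does not matter). -/
def inv (k : Fin 5) (θ : JetCoord) : ℝ := invOfEq (taylor θ) k θ.1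

/-- The natural domain of `I¹, …, I⁵` in `J³π`: the generic jets, `Λ₁ ≠ 0` and `Λ₂ ≠ 0`. -/
def genericJ3 : Set JetCoord :=
  {θ ∈ J3 | Lam1 (taylor θ) θ.1 ≠ 0 ∧ Lam2 (taylor θ) θ.1 ≠ 0}

/-- Functional independence of `f₁, …, f_n` on a set `U`: the differentials are linearly
independent at all points of a subset of `U` that is open and dense in `U`. -/
def FunctionallyIndependentOn {V : Type*} [NormedAddCommGroup V] [NormedSpace ℝ V] {n : ℕ}
    (f : Fin n → V → ℝ) (U : Set V) : Prop :=
  ∃ W ⊆ U, IsOpen W ∧ U ⊆ closure W ∧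
    ∀ θ ∈ W, (∀ k, DifferentiableAt ℝ (f k) θ) ∧
      LinearIndependent ℝ (fun k => fderiv ℝ (f k) θ)

end

end MongeAmpere

namespace MongeAmpere

noncomputable section

/-! ### Operators that depend smoothly on jets -/

/-! All five invariants are elementary functions of six operators (`basicOp`): `Λ₁`, `Λ₁₂`, `Λ₂` and
the numerators of the three `I¹_σ`.

Order: `X₁, …, X₄` are algebraic in `u`, `X₅` uses one derivative, `bⁱ_{j5}` two, the numerators
three. `Rep J T` records that `T` is an analytic function of the operator `J`; a differentiation
costs one prolongation of `J` (`Rep.fderiv`). Prolongations are iterated without identifying mixed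
derivatives, so one must check that sections with equal partial derivatives have equal iterated
prolongations (`agree_of_multiDeriv`, `Agree.J3_eq`). A Taylor polynomial realises every jet
(`multiDeriv_taylor`), hence the values depend only on the jet; it is polynomial in the jet
coordinates, hence the six functions are analytic on `J3`.

Density: `J3` is an open half-space, so an analytic function that is nonzero somewhere on it is
nonzero on a dense subset (`subset_closure_ne_zero`). This is applied to `nondeg`, the product of
the six functions and of a 6×6 minor of their differentials. Each factor needs only one jet where it
is nonzero, found in the family `exSec`: `u¹ = u⁴ = 0`, and `u²`, `u³` quadratic in `x, y` with
coefficients affine in `z`. On the `z`-axis `X₅ = -∂z`, `B = 0` and `Λ₁ = ab`, `Λ₁₂ = b + ac`, `Λ₂ =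
c` with `a, b, c` affine in `z`; the numerators are minus the `z`-derivatives. At the parameter
`exPt` the minor is diagonal with entries `±1` (although `Λ₁ = Λ₂ = 0` there), and when all
parameters are `1` the six functions are nonzero.

Where `nondeg ≠ 0`, the six differentials are independent, and the invariants, as functions of the
six values, have a triangular Jacobian block (`fderiv_invFun_of_ne`, `fderiv_invFun_self`). -/

/-- `u` is a hyperbolic section near `y`, of class `C³`. -/
def Hyp (u : M → Fin 4 → ℝ) (y : M) : Prop := ContDiffAt ℝ 3 u y ∧ u y 1 < u y 2

theorem Hyp.eventually {u : M → Fin 4 → ℝ} {y : M} (h : Hyp u y) :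
    ∀ᶠ y' in nhds y, Hyp u y' := by
  have hc : ContinuousAt u y := h.1.continuousAt
  have h1 : ContinuousAt (fun y' => u y' 1) y := continuousAt_pi.1 hc 1
  have h2 : ContinuousAt (fun y' => u y' 2) y := continuousAt_pi.1 hc 2
  exact (h.1.eventually (by simp)).and (h1.eventually_lt h2 h.2)

theorem Hyp.differentiableAt {u : M → Fin 4 → ℝ} {y : M} (h : Hyp u y) :
    DifferentiableAt ℝ u y := h.1.differentiableAt (by simp)

section Rep

variable {E F F' : Type*} [NormedAddCommGroup E] [NormedSpace ℝ E]
  [NormedAddCommGroup F] [NormedSpace ℝ F] [NormedAddCommGroup F'] [NormedSpace ℝ F']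

/-- The operator `T` on sections is an analytic function of the values of the operator `J`. -/
def Rep (J : (M → Fin 4 → ℝ) → M → E) (T : (M → Fin 4 → ℝ) → M → F) : Prop :=
  ∃ G : E → F, ∀ u y, Hyp u y → ContDiffAt ℝ ω G (J u y) ∧ T u y = G (J u y)

/-- The prolongation of an operator: the operator together with its derivative. -/
def prol (J : (M → Fin 4 → ℝ) → M → E) : (M → Fin 4 → ℝ) → M → E × (M →L[ℝ] E) :=
  fun u y => (J u y, fderiv ℝ (J u) y)

variable {J : (M → Fin 4 → ℝ) → M → E} {T : (M → Fin 4 → ℝ) → M → F}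
  {T' : (M → Fin 4 → ℝ) → M → F'}

theorem Rep.comp {Φ : F → F'} (h : Rep J T) (hΦ : ∀ u y, Hyp u y → ContDiffAt ℝ ω Φ (T u y)) :
    Rep J (fun u y => Φ (T u y)) := by
  obtain ⟨G, hG⟩ := h
  refine ⟨Φ ∘ G, fun u y hu => ⟨?_, ?_⟩⟩
  · exact ContDiffAt.comp _ ((hG u y hu).2 ▸ hΦ u y hu) (hG u y hu).1
  · simp [(hG u y hu).2]

theorem Rep.prodMk (h : Rep J T) (h' : Rep J T') : Rep J (fun u y => (T u y, T' u y)) := by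
  obtain ⟨G, hG⟩ := h
  obtain ⟨G', hG'⟩ := h'
  exact ⟨fun e => (G e, G' e), fun u y hu => ⟨(hG u y hu).1.prodMk (hG' u y hu).1,
    Prod.ext (hG u y hu).2 (hG' u y hu).2⟩⟩

theorem Rep.pi {n : ℕ} {T : Fin n → (M → Fin 4 → ℝ) → M → F} (h : ∀ i, Rep J (T i)) :
    Rep J (fun u y i => T i u y) := by
  choose G hG using h
  exact ⟨fun e i => G i e, fun u y hu => ⟨contDiffAt_pi.2 fun i => (hG i u y hu).1,
    funext fun i => (hG i u y hu).2⟩⟩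

theorem Rep.prol (h : Rep J T) : Rep (prol J) T := by
  obtain ⟨G, hG⟩ := h
  exact ⟨fun e => G e.1, fun u y hu =>
    ⟨ContDiffAt.comp (MongeAmpere.prol J u y) (hG u y hu).1 contDiffAt_fst, (hG u y hu).2⟩⟩

/-- Chain rule: the derivative is `G'(J u y) ∘ D(J u)(y)`, analytic in the two components of `prol
J`. -/
theorem Rep.fderiv (h : Rep J T) (hJ : ∀ u y, Hyp u y → DifferentiableAt ℝ (J u) y) :
    Rep (MongeAmpere.prol J) (fun u y => fderiv ℝ (T u) y) := by
  obtain ⟨G, hG⟩ := h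
  refine ⟨fun e => (_root_.fderiv ℝ G e.1).comp e.2, fun u y hu => ⟨?_, ?_⟩⟩
  · have h1 : ContDiffAt ℝ ω (_root_.fderiv ℝ G) (J u y) :=
      (hG u y hu).1.fderiv_right (by simp)
    exact ContDiffAt.clm_comp (ContDiffAt.comp (MongeAmpere.prol J u y) h1 contDiffAt_fst)
      contDiffAt_snd
  -- Differentiating needs the identity on a neighbourhood, which exists because `Hyp` is an open
  -- condition.
  · have h1 : T u =ᶠ[nhds y] G ∘ J u := by
      filter_upwards [hu.eventually] with y' hy'
      exact (hG u y' hy').2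
    exact h1.fderiv_eq.trans
      (fderiv_comp _ ((hG u y hu).1.differentiableAt (by simp)) (hJ u y hu))

theorem Rep.mul {S T : (M → Fin 4 → ℝ) → M → ℝ} (h : Rep J S) (h' : Rep J T) :
    Rep J (fun u y => S u y * T u y) :=
  (h.prodMk h').comp (Φ := fun e => e.1 * e.2) fun _ _ _ => by fun_prop

theorem Rep.add {S T : (M → Fin 4 → ℝ) → M → F} (h : Rep J S) (h' : Rep J T) :
    Rep J (fun u y => S u y + T u y) :=
  (h.prodMk h').comp (Φ := fun e => e.1 + e.2) fun _ _ _ => by fun_prop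

theorem Rep.sub {S T : (M → Fin 4 → ℝ) → M → F} (h : Rep J S) (h' : Rep J T) :
    Rep J (fun u y => S u y - T u y) :=
  (h.prodMk h').comp (Φ := fun e => e.1 - e.2) fun _ _ _ => by fun_prop

theorem Rep.smul {S : (M → Fin 4 → ℝ) → M → ℝ} (h : Rep J S) (h' : Rep J T) :
    Rep J (fun u y => S u y • T u y) :=
  (h.prodMk h').comp (Φ := fun e => e.1 • e.2) fun _ _ _ => by fun_prop

theorem Rep.clm_apply {S : (M → Fin 4 → ℝ) → M → F →L[ℝ] F'} (h : Rep J S) (h' : Rep J T) :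
    Rep J (fun u y => S u y (T u y)) :=
  (h.prodMk h').comp (Φ := fun e => e.1 e.2) fun _ _ _ => by fun_prop

/-- Only `f` is differentiated, so `X` may already have the order of the result. -/
theorem Rep.along {X : (M → Fin 4 → ℝ) → M → M} {f : (M → Fin 4 → ℝ) → M → ℝ}
    (hX : Rep (MongeAmpere.prol J) X) (hf : Rep J f)
    (hJ : ∀ u y, Hyp u y → DifferentiableAt ℝ (J u) y) :
    Rep (MongeAmpere.prol J) (fun u => MongeAmpere.along (X u) (f u)) :=
  (hf.fderiv hJ).clm_apply hX

theorem Rep.lieBracket {X Y : (M → Fin 4 → ℝ) → M → M} (hX : Rep J X) (hY : Rep J Y)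
    (hJ : ∀ u y, Hyp u y → DifferentiableAt ℝ (J u) y) :
    Rep (MongeAmpere.prol J) (fun u => VectorField.lieBracket ℝ (X u) (Y u)) :=
  ((hY.fderiv hJ).clm_apply hX.prol).sub ((hX.fderiv hJ).clm_apply hY.prol)

end Rep

/-! ### Orders of the frame, of the structure functions and of the basic operators -/

/-- The jet of order `0`. -/
def J0 (u : M → Fin 4 → ℝ) (y : M) : M × (Fin 4 → ℝ) := (y, u y)

/-- The (nonholonomic) jet of order `1`. -/
abbrev J1 := prol J0

/-- The (nonholonomic) jet of order `2`. -/
abbrev J2 := prol J1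

theorem contDiffAt_prol {E : Type*} [NormedAddCommGroup E] [NormedSpace ℝ E]
    {J : (M → Fin 4 → ℝ) → M → E} {u : M → Fin 4 → ℝ} {y : M} {m n : WithTop ℕ∞}
    (h : ContDiffAt ℝ n (J u) y) (hmn : m + 1 ≤ n) : ContDiffAt ℝ m (prol J u) y :=
  (h.of_le (le_self_add.trans hmn)).prodMk (h.fderiv_right hmn)

theorem contDiffAt_J0 {u : M → Fin 4 → ℝ} {y : M} {n : WithTop ℕ∞}
    (h : ContDiffAt ℝ n u y) : ContDiffAt ℝ n (J0 u) y := contDiffAt_id.prodMk h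

theorem Hyp.contDiffAt_J1 {u : M → Fin 4 → ℝ} {y : M} (h : Hyp u y) :
    ContDiffAt ℝ 2 (J1 u) y := contDiffAt_prol (contDiffAt_J0 h.1) (by norm_num)

theorem Hyp.contDiffAt_J2 {u : M → Fin 4 → ℝ} {y : M} (h : Hyp u y) :
    ContDiffAt ℝ 1 (J2 u) y := contDiffAt_prol h.contDiffAt_J1 (by norm_num)

theorem Hyp.differentiableAt_J0 (u : M → Fin 4 → ℝ) (y : M) (h : Hyp u y) :
    DifferentiableAt ℝ (J0 u) y := (contDiffAt_J0 h.1).differentiableAt (by simp)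

theorem Hyp.differentiableAt_J1 (u : M → Fin 4 → ℝ) (y : M) (h : Hyp u y) :
    DifferentiableAt ℝ (J1 u) y := h.contDiffAt_J1.differentiableAt (by simp)

theorem Hyp.differentiableAt_J2 (u : M → Fin 4 → ℝ) (y : M) (h : Hyp u y) :
    DifferentiableAt ℝ (J2 u) y := h.contDiffAt_J2.differentiableAt (by simp)

theorem rep_coord (i : Fin 4) : Rep J0 (fun u y => u y i) :=
  ⟨fun e => e.2 i, fun _ _ _ => ⟨by fun_prop, rfl⟩⟩

theorem rep_frame_vec (a b : ℝ) (j : Fin 5) (i k : Fin 4) :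
    Rep J0 (fun u y => (![a, b, y j, u y i, u y k] : M)) := by
  refine ⟨fun e => ![a, b, e.1 j, e.2 i, e.2 k], fun u y _ => ⟨?_, rfl⟩⟩
  refine contDiffAt_pi.2 fun l => ?_
  fin_cases l
  · exact contDiffAt_const
  · exact contDiffAt_const
  · change ContDiffAt ℝ ω (fun e : M × (Fin 4 → ℝ) => e.1 j) _; fun_prop
  · change ContDiffAt ℝ ω (fun e : M × (Fin 4 → ℝ) => e.2 i) _; fun_prop
  · change ContDiffAt ℝ ω (fun e : M × (Fin 4 → ℝ) => e.2 k) _; fun_prop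

theorem rep_X1 : Rep J0 X1 := rep_frame_vec 1 0 3 0 1
theorem rep_X2 : Rep J0 X2 := rep_frame_vec 0 1 4 2 3
theorem rep_X3 : Rep J0 X3 := rep_frame_vec 1 0 3 0 2
theorem rep_X4 : Rep J0 X4 := rep_frame_vec 0 1 4 1 3

theorem Rep.div_diff {E : Type*} [NormedAddCommGroup E] [NormedSpace ℝ E]
    {J : (M → Fin 4 → ℝ) → M → E} {T : (M → Fin 4 → ℝ) → M → ℝ} (h : Rep J T)
    (h' : ∀ i, Rep J (fun u y => u y i)) : Rep J (fun u y => T u y / (u y 1 - u y 2)) :=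
  (h.prodMk ((h' 1).sub (h' 2))).comp (Φ := fun e => e.1 / e.2) fun _ _ hu =>
    contDiffAt_fst.div contDiffAt_snd (sub_ne_zero.2 hu.2.ne)

theorem rep_along0 {X : (M → Fin 4 → ℝ) → M → M} (hX : Rep J0 X) (i : Fin 4) :
    Rep J1 (fun u => along (X u) (fun y => u y i)) :=
  hX.prol.along (rep_coord i) Hyp.differentiableAt_J0

theorem rep_lam1 : Rep J1 lam1 :=
  ((((rep_along0 rep_X2 1).add (rep_along0 rep_X4 2)).sub (rep_along0 rep_X1 3)).sub
    (rep_along0 rep_X3 3)).div_diff fun i => (rep_coord i).prol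

theorem rep_lam2 : Rep J1 lam2 :=
  ((((rep_along0 rep_X1 2).add (rep_along0 rep_X3 1)).sub (rep_along0 rep_X2 0)).sub
    (rep_along0 rep_X4 0)).div_diff fun i => (rep_coord i).prol

theorem rep_X5 : Rep J1 X5 :=
  ((rep_lam1.smul rep_X1.prol).add (rep_lam2.smul rep_X2.prol)).add
    (rep_X1.lieBracket rep_X2 Hyp.differentiableAt_J0)

theorem rep_frame (j : Fin 5) : Rep J1 (fun u => frame u j) := by
  fin_cases j
  exacts [rep_X1.prol, rep_X2.prol, rep_X3.prol, rep_X4.prol, rep_X5]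

theorem contDiff_det_of {n : ℕ} {E : Type*} [NormedAddCommGroup E] [NormedSpace ℝ E]
    {k : WithTop ℕ∞} {A : E → Matrix (Fin n) (Fin n) ℝ} {e : E}
    (h : ∀ i j, ContDiffAt ℝ k (fun e => A e i j) e) :
    ContDiffAt ℝ k (fun e => (A e).det) e := by
  simp only [Matrix.det_apply]
  refine ContDiffAt.sum fun σ _ => ?_
  refine ContDiffAt.const_smul _ ?_
  exact contDiffAt_prod fun i _ => h _ _

/-- Cramer's rule: the inverse is the adjugate over the determinant, rational with nonvanishing
denominator. -/
theorem contDiffAt_inv_mulVec {n : ℕ} (i : Fin n)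
    (e : (Fin n → Fin n → ℝ) × (Fin n → ℝ)) (h : (Matrix.of e.1).det ≠ 0) :
    ContDiffAt ℝ ω (fun e : (Fin n → Fin n → ℝ) × (Fin n → ℝ) =>
      ((Matrix.of e.1)⁻¹.mulVec e.2) i) e := by
  have hentry : ∀ i j, ContDiffAt ℝ ω
      (fun e : (Fin n → Fin n → ℝ) × (Fin n → ℝ) => Matrix.of e.1 i j) e := by
    intro i j
    simp only [Matrix.of_apply]
    fun_prop
  have hdet := contDiff_det_of hentry
  have hadj : ∀ i j, ContDiffAt ℝ ω
      (fun e : (Fin n → Fin n → ℝ) × (Fin n → ℝ) => (Matrix.of e.1).adjugate i j) e := by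
    intro i j
    simp only [Matrix.adjugate_apply]
    refine contDiff_det_of fun k l => ?_
    by_cases hk : k = j
    · subst hk; simpa using contDiffAt_const
    · simpa [Matrix.updateRow_ne hk] using hentry k l
  simp only [Matrix.inv_def, Matrix.mulVec, dotProduct, Matrix.smul_apply, smul_eq_mul,
    Ring.inverse_eq_inv']
  refine ContDiffAt.sum fun j _ => ?_
  exact ((hdet.inv h).mul (hadj i j)).mul (by fun_prop)

/-- A bracket costs one derivative and `X₅` already has order one, hence order two. The denominator
is the frame determinant `(u² - u³)³`, nonzero by hyperbolicity. -/
theorem rep_b (i j : Fin 5) : Rep J2 (fun u => b u i j 4) := by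
  have h1 : Rep J2 (fun u y (i j : Fin 5) => frame u j y i) :=
    Rep.pi fun i => Rep.pi fun j =>
      (rep_frame j).prol.comp (Φ := fun v : M => v i) fun _ _ _ => by fun_prop
  have h2 : Rep J2 (fun u => VectorField.lieBracket ℝ (frame u j) (frame u 4)) :=
    (rep_frame j).lieBracket (rep_frame 4) Hyp.differentiableAt_J1
  refine (h1.prodMk h2).comp (Φ := fun e : (Fin 5 → Fin 5 → ℝ) × (Fin 5 → ℝ) =>
      ((Matrix.of e.1)⁻¹.mulVec e.2) i) fun u y hu => contDiffAt_inv_mulVec i _ ?_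
  change (frameMatrix u y).det ≠ 0
  rw [det_frameMatrix u y hu.differentiableAt]
  exact pow_ne_zero _ (sub_ne_zero.2 hu.2.ne)

theorem rep_Lam1 : Rep J2 Lam1 :=
  ((rep_b 1 2).mul (rep_b 0 3)).sub ((rep_b 0 2).mul (rep_b 1 3))

theorem rep_Lam2 : Rep J2 Lam2 :=
  ((rep_b 3 0).mul (rep_b 2 1)).sub ((rep_b 2 0).mul (rep_b 3 1))

theorem rep_Lam12 : Rep J2 Lam12 :=
  ((((rep_b 2 0).mul (rep_b 0 2)).add ((rep_b 3 0).mul (rep_b 0 3))).add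
    ((rep_b 2 1).mul (rep_b 1 2))).add ((rep_b 3 1).mul (rep_b 1 3))

theorem rep_Bsum : Rep J2 Bsum :=
  (((rep_b 0 0).add (rep_b 1 1)).add (rep_b 2 2)).add (rep_b 3 3)

/-- The numerator of the invariant `I¹_σ`. -/
def numer (L : (M → Fin 4 → ℝ) → M → ℝ) (u : M → Fin 4 → ℝ) : M → ℝ := fun y =>
  along (X5 u) (L u) y + L u y * Bsum u y

set_option synthInstance.maxSize 10000 in
theorem rep_numer {L : (M → Fin 4 → ℝ) → M → ℝ} (hL : Rep J2 L) : Rep (prol J2) (numer L) :=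
  (rep_X5.prol.prol.along hL Hyp.differentiableAt_J2).add (hL.prol.mul rep_Bsum.prol)

/-- The functions `Λ₁`, `Λ₁₂`, `Λ₂` and the numerators of the corresponding `I¹_σ`. -/
def basicOp : Fin 6 → (M → Fin 4 → ℝ) → M → ℝ :=
  ![Lam1, Lam12, Lam2, numer Lam1, numer Lam12, numer Lam2]

set_option synthInstance.maxSize 10000 in
theorem rep_basicOp (i : Fin 6) : Rep (prol J2) (basicOp i) := by
  fin_cases i
  exacts [rep_Lam1.prol, rep_Lam12.prol, rep_Lam2.prol, rep_numer rep_Lam1, rep_numer rep_Lam12,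
    rep_numer rep_Lam2]

/-! ### Sections with the same jet -/

section Agree

variable {F F' : Type*} [NormedAddCommGroup F] [NormedSpace ℝ F] [NormedAddCommGroup F']
  [NormedSpace ℝ F'] {x : M}

/-- The derivatives of `f` and `g` at `x` up to the order `n` are the same. -/
def Agree (n : ℕ) (f g : M → F) (x : M) : Prop :=
  ∀ m ≤ n, iteratedFDeriv ℝ m f x = iteratedFDeriv ℝ m g x

theorem Agree.eq {n : ℕ} {f g : M → F} (h : Agree n f g x) : f x = g x := by
  have := congrArg (fun L => L 0) (h 0 n.zero_le)
  simpa using this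

theorem agree_zero {f g : M → F} (h : f x = g x) : Agree 0 f g x := by
  intro m hm
  obtain rfl : m = 0 := by omega
  ext
  simpa using h

theorem Agree.mono {m n : ℕ} {f g : M → F} (h : Agree n f g x) (hmn : m ≤ n) : Agree m f g x :=
  fun k hk => h k (hk.trans hmn)

theorem agree_refl (n : ℕ) (f : M → F) : Agree n f f x := fun _ _ => rfl

theorem Agree.fderiv {n : ℕ} {f g : M → F} (h : Agree (n + 1) f g x) :
    Agree n (fderiv ℝ f) (fderiv ℝ g) x := by
  intro m hm
  have := h (m + 1) (by omega)
  simpa [iteratedFDeriv_succ_eq_comp_right] using this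

theorem agree_succ {n : ℕ} {f g : M → F} (h0 : f x = g x)
    (h : Agree n (_root_.fderiv ℝ f) (_root_.fderiv ℝ g) x) : Agree (n + 1) f g x := by
  intro m hm
  cases m with
  | zero => exact agree_zero h0 0 le_rfl
  | succ m =>
    have := h m (by omega)
    simpa [iteratedFDeriv_succ_eq_comp_right] using this

theorem Agree.clm {n : ℕ} {f g : M → F} (h : Agree n f g x) (L : F →L[ℝ] F')
    (hf : ContDiffAt ℝ ∞ f x) (hg : ContDiffAt ℝ ∞ g x) :
    Agree n (fun y => L (f y)) (fun y => L (g y)) x := by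
  intro m hm
  have e1 := L.iteratedFDeriv_comp_left (i := m) hf (by exact_mod_cast le_top)
  have e2 := L.iteratedFDeriv_comp_left (i := m) hg (by exact_mod_cast le_top)
  exact e1.trans ((congrArg _ (h m hm)).trans e2.symm)

theorem Agree.sum {ι : Type*} {s : Finset ι} {n : ℕ} {f g : ι → M → F}
    (h : ∀ i ∈ s, Agree n (f i) (g i) x)
    (hf : ∀ i ∈ s, ContDiffAt ℝ ∞ (f i) x) (hg : ∀ i ∈ s, ContDiffAt ℝ ∞ (g i) x) :
    Agree n (fun y => ∑ i ∈ s, f i y) (fun y => ∑ i ∈ s, g i y) x := by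
  intro m hm
  have e1 := iteratedFDeriv_sum_apply (𝕜 := ℝ) (n := m) (f := f) (u := s) (x := x)
    fun i hi => (hf i hi).of_le (by exact_mod_cast le_top)
  have e2 := iteratedFDeriv_sum_apply (𝕜 := ℝ) (n := m) (f := g) (u := s) (x := x)
    fun i hi => (hg i hi).of_le (by exact_mod_cast le_top)
  have h1 : ∀ f : ι → M → F, (fun y => ∑ i ∈ s, f i y) = ∑ i ∈ s, f i := by
    intro f; ext; simp
  rw [h1, h1, e1, e2]
  exact Finset.sum_congr rfl fun i hi => h i hi m hm

theorem Agree.add {n : ℕ} {f g f' g' : M → F} (h : Agree n f g x) (h' : Agree n f' g' x)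
    (hf : ContDiffAt ℝ ∞ f x) (hg : ContDiffAt ℝ ∞ g x)
    (hf' : ContDiffAt ℝ ∞ f' x) (hg' : ContDiffAt ℝ ∞ g' x) :
    Agree n (fun y => f y + f' y) (fun y => g y + g' y) x := by
  have := Agree.sum (s := Finset.univ) (n := n) (f := ![f, f']) (g := ![g, g']) (x := x)
    (by simp [Fin.forall_fin_two, h, h']) (by simp [Fin.forall_fin_two, hf, hf'])
    (by simp [Fin.forall_fin_two, hg, hg'])
  simpa using this

theorem Agree.prodMk {n : ℕ} {f g : M → F} {f' g' : M → F'} (h : Agree n f g x)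
    (h' : Agree n f' g' x) (hf : ContDiffAt ℝ ∞ f x) (hg : ContDiffAt ℝ ∞ g x)
    (hf' : ContDiffAt ℝ ∞ f' x) (hg' : ContDiffAt ℝ ∞ g' x) :
    Agree n (fun y => (f y, f' y)) (fun y => (g y, g' y)) x := by
  have hl := h.clm (.inl ℝ F F') hf hg
  have hr := h'.clm (.inr ℝ F F') hf' hg'
  have := hl.add hr ((ContinuousLinearMap.contDiff _).contDiffAt.comp x hf)
    ((ContinuousLinearMap.contDiff _).contDiffAt.comp x hg)
    ((ContinuousLinearMap.contDiff _).contDiffAt.comp x hf')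
    ((ContinuousLinearMap.contDiff _).contDiffAt.comp x hg')
  simpa using this

end Agree

/-- Each prolongation spends one order of agreement, so agreement to order `k` yields equality of
the `k`-th prolongations at the point. -/
theorem Agree.prol {E : Type*} [NormedAddCommGroup E] [NormedSpace ℝ E]
    {J : (M → Fin 4 → ℝ) → M → E} {u v : M → Fin 4 → ℝ} {x : M} {n : ℕ}
    (h : Agree (n + 1) (J u) (J v) x) (hu : ContDiffAt ℝ ∞ (J u) x)
    (hv : ContDiffAt ℝ ∞ (J v) x) : Agree n (prol J u) (prol J v) x :=
  (h.mono n.le_succ).prodMk h.fderiv hu hv (hu.fderiv_right (by simp)) (hv.fderiv_right (by simp))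

theorem Agree.J2_eq {u v : M → Fin 4 → ℝ} {x : M} (h : Agree 2 u v x)
    (hu : ContDiffAt ℝ ∞ u x) (hv : ContDiffAt ℝ ∞ v x) : J2 u x = J2 v x := by
  have h0 : Agree 2 (J0 u) (J0 v) x :=
    (agree_refl 2 (fun y => y)).prodMk h contDiffAt_id contDiffAt_id hu hv
  have h1 := h0.prol (contDiffAt_J0 hu) (contDiffAt_J0 hv)
  exact (h1.prol (contDiffAt_prol (contDiffAt_J0 hu) (by simp))
    (contDiffAt_prol (contDiffAt_J0 hv) (by simp))).eq

set_option synthInstance.maxSize 10000 in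
theorem Agree.J3_eq {u v : M → Fin 4 → ℝ} {x : M} (h : Agree 3 u v x)
    (hu : ContDiffAt ℝ ∞ u x) (hv : ContDiffAt ℝ ∞ v x) :
    MongeAmpere.prol J2 u x = MongeAmpere.prol J2 v x := by
  have h0 : Agree 3 (J0 u) (J0 v) x :=
    (agree_refl 3 (fun y => y)).prodMk h contDiffAt_id contDiffAt_id hu hv
  have cu := contDiffAt_J0 hu
  have cv := contDiffAt_J0 hv
  have h1 := h0.prol cu cv
  have cu1 : ContDiffAt ℝ ∞ (J1 u) x := contDiffAt_prol cu (by simp)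
  have cv1 : ContDiffAt ℝ ∞ (J1 v) x := contDiffAt_prol cv (by simp)
  have h2 := h1.prol cu1 cv1
  exact (h2.prol (contDiffAt_prol cu1 (by simp)) (contDiffAt_prol cv1 (by simp))).eq

/-! ### Iterated partial derivatives -/

theorem ContDiffAt.pderiv {f : M → ℝ} {x : M} {m n : WithTop ℕ∞} (h : ContDiffAt ℝ n f x)
    (hmn : m + 1 ≤ n) (j : Fin 5) : ContDiffAt ℝ m (pderiv j f) x :=
  (h.fderiv_right hmn).clm_apply contDiffAt_const

theorem ContDiffAt.pderiv_iterate {f : M → ℝ} {x : M} (h : ContDiffAt ℝ ∞ f x) (j : Fin 5)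
    (k : ℕ) : ContDiffAt ℝ ∞ ((MongeAmpere.pderiv j)^[k] f) x := by
  induction k generalizing f with
  | zero => exact h
  | succ k ih => exact ih (ContDiffAt.pderiv h (by simp) j)

theorem pderiv_congr {f g : M → ℝ} {x : M} (h : f =ᶠ[nhds x] g) (j : Fin 5) :
    pderiv j f =ᶠ[nhds x] pderiv j g := by
  filter_upwards [h.fderiv (𝕜 := ℝ)] with y hy
  simp [pderiv, hy]

theorem pderiv_iterate_congr {f g : M → ℝ} {x : M} (h : f =ᶠ[nhds x] g) (j : Fin 5) (k : ℕ) :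
    (pderiv j)^[k] f =ᶠ[nhds x] (pderiv j)^[k] g := by
  induction k generalizing f g with
  | zero => exact h
  | succ k ih => exact ih (pderiv_congr h j)

/-- Symmetry of the second derivative, kept as an identity near `x` so that it can be differentiated
again. -/
theorem pderiv_comm {f : M → ℝ} {x : M} (h : ContDiffAt ℝ ∞ f x) (i j : Fin 5) :
    pderiv i (pderiv j f) =ᶠ[nhds x] pderiv j (pderiv i f) := by
  have h2 : ContDiffAt ℝ 2 f x :=
    by exact_mod_cast contDiffAt_infty.1 h 2
  filter_upwards [h2.eventually (by simp)] with y hy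
  have hs : IsSymmSndFDerivAt ℝ f y := hy.isSymmSndFDerivAt (by simp)
  have hd : DifferentiableAt ℝ (fderiv ℝ f) y :=
    (hy.fderiv_right (m := 1) (by norm_num)).differentiableAt (by simp)
  have key : ∀ i j, pderiv i (pderiv j f) y
      = fderiv ℝ (fderiv ℝ f) y (Pi.single i 1) (Pi.single j 1) := by
    intro i j
    change fderiv ℝ (fun y => fderiv ℝ f y (Pi.single j 1)) y (Pi.single i 1) = _
    rw [fderiv_clm_apply hd (differentiableAt_const _)]
    simp
  rw [key, key, hs.eq]

theorem pderiv_iterate_comm {f : M → ℝ} {x : M} (h : ContDiffAt ℝ ∞ f x) (i j : Fin 5) (k : ℕ) :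
    (pderiv i)^[k] (pderiv j f) =ᶠ[nhds x] pderiv j ((pderiv i)^[k] f) := by
  induction k generalizing f with
  | zero => exact Filter.EventuallyEq.rfl
  | succ k ih =>
    exact (pderiv_iterate_congr (pderiv_comm h i j) i k).trans
      (ih (ContDiffAt.pderiv h (by simp) i))

/-- The iterated partial derivative for a multi-index of arbitrary order. -/
def iterDeriv (σ : Fin 5 → ℕ) (f : M → ℝ) : M → ℝ :=
  (pderiv 0)^[σ 0] ((pderiv 1)^[σ 1] ((pderiv 2)^[σ 2] ((pderiv 3)^[σ 3] ((pderiv 4)^[σ 4] f))))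

/-- `iterDeriv` fixes the order of the differentiations. The innermost `∂_j` is moved outwards past
the blocks `4, …, j` and then counted in block `j`. -/
theorem iterDeriv_pderiv {f : M → ℝ} {x : M} (h : ContDiffAt ℝ ∞ f x) (σ : Fin 5 → ℕ)
    (j : Fin 5) :
    iterDeriv σ (pderiv j f) =ᶠ[nhds x] iterDeriv (σ + Pi.single j 1) f := by
  have c4 := ContDiffAt.pderiv_iterate h 4 (σ 4)
  have c3 := ContDiffAt.pderiv_iterate c4 3 (σ 3)
  have c2 := ContDiffAt.pderiv_iterate c3 2 (σ 2)
  have c1 := ContDiffAt.pderiv_iterate c2 1 (σ 1)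
  have e4 := pderiv_iterate_comm h 4 j (σ 4)
  have e3 := (pderiv_iterate_congr e4 3 (σ 3)).trans (pderiv_iterate_comm c4 3 j (σ 3))
  have e2 := (pderiv_iterate_congr e3 2 (σ 2)).trans (pderiv_iterate_comm c3 2 j (σ 2))
  have e1 := (pderiv_iterate_congr e2 1 (σ 1)).trans (pderiv_iterate_comm c2 1 j (σ 1))
  have e0 := (pderiv_iterate_congr e1 0 (σ 0)).trans (pderiv_iterate_comm c1 0 j (σ 0))
  have hs := fun k => Function.iterate_succ_apply' (pderiv k)
  fin_cases j
  · simpa [iterDeriv, hs] using e0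
  · simpa [iterDeriv, hs] using pderiv_iterate_congr e1 0 (σ 0)
  · simpa [iterDeriv, hs] using pderiv_iterate_congr (pderiv_iterate_congr e2 1 (σ 1)) 0 (σ 0)
  · simpa [iterDeriv, hs] using pderiv_iterate_congr
      (pderiv_iterate_congr (pderiv_iterate_congr e3 2 (σ 2)) 1 (σ 1)) 0 (σ 0)
  · simp [iterDeriv]

theorem fderiv_eq_sum_pderiv (f : M → ℝ) :
    fderiv ℝ f = fun y => ∑ j : Fin 5,
      ContinuousLinearMap.smulRight (1 : ℝ →L[ℝ] ℝ)
        (ContinuousLinearMap.proj (R := ℝ) (φ := fun _ : Fin 5 => ℝ) j) (pderiv j f y) := by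
  funext y
  ext v
  have hv : v = ∑ j, v j • (Pi.single j 1 : M) := by
    ext k
    simp [Finset.sum_apply, Pi.single_apply]
  conv_lhs => rw [hv, map_sum]
  simp [pderiv, mul_comm]

/-- Induction through the differential, a constant linear combination of the `∂_j f`: since `∂^σ ∂_j
= ∂^(σ + e_j)`, agreement of the `∂_j` to order `n` is the hypothesis at order `n + 1`. -/
theorem agree_of_iterDeriv {n : ℕ} {f g : M → ℝ} {x : M} (hf : ContDiffAt ℝ ∞ f x)
    (hg : ContDiffAt ℝ ∞ g x)
    (h : ∀ σ : Fin 5 → ℕ, ∑ j, σ j ≤ n → iterDeriv σ f x = iterDeriv σ g x) :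
    Agree n f g x := by
  have h0 : f x = g x := h 0 (by simp)
  induction n generalizing f g with
  | zero => exact agree_zero h0
  | succ n ih =>
    refine agree_succ h0 ?_
    rw [fderiv_eq_sum_pderiv f, fderiv_eq_sum_pderiv g]
    have cf := fun j => ContDiffAt.pderiv hf (m := ∞) (by simp) j
    have cg := fun j => ContDiffAt.pderiv hg (m := ∞) (by simp) j
    refine Agree.sum (fun j _ => ?_)
      (fun j _ => (ContinuousLinearMap.contDiff _).contDiffAt.comp x (cf j))
      (fun j _ => (ContinuousLinearMap.contDiff _).contDiffAt.comp x (cg j))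
    have h1 : ∀ σ : Fin 5 → ℕ, ∑ j, σ j ≤ n →
        iterDeriv σ (pderiv j f) x = iterDeriv σ (pderiv j g) x := by
      intro σ hσ
      rw [(iterDeriv_pderiv hf σ j).eq_of_nhds, (iterDeriv_pderiv hg σ j).eq_of_nhds]
      refine h _ ?_
      simp [Finset.sum_add_distrib, hσ]
    exact (ih (cf j) (cg j) h1 (h1 0 (by simp))).clm _ (cf j) (cg j)

theorem contDiffAt_coord {u : M → Fin 4 → ℝ} {x : M} {n : WithTop ℕ∞}
    (hu : ContDiffAt ℝ n u x) (i : Fin 4) : ContDiffAt ℝ n (fun y => u y i) x :=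
  contDiffAt_pi.1 hu i

theorem agree_of_multiDeriv {n : ℕ} (hn : n ≤ 3) {u v : M → Fin 4 → ℝ} {x : M}
    (hu : ContDiffAt ℝ ∞ u x) (hv : ContDiffAt ℝ ∞ v x)
    (h : ∀ σ : MultiIdx, σ.order ≤ n → ∀ i,
      multiDeriv σ (fun y => u y i) x = multiDeriv σ (fun y => v y i) x) : Agree n u v x := by
  have hc : ∀ i, Agree n (fun y => u y i) (fun y => v y i) x := by
    intro i
    refine agree_of_iterDeriv (contDiffAt_coord hu i) (contDiffAt_coord hv i) fun σ hσ => ?_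
    -- A total order of at most `3` is what allows the entries to be stored in `Fin 4`.
    have hlt : ∀ j, σ j < 4 := fun j => by
      have := Finset.single_le_sum (f := σ) (fun _ _ => Nat.zero_le _) (Finset.mem_univ j)
      omega
    exact h ⟨fun j => ⟨σ j, hlt j⟩, by simpa using hσ.trans hn⟩ (by simpa [MultiIdx.order]) i
  have hs : ∀ u : M → Fin 4 → ℝ, u = fun y => ∑ i : Fin 4,
      ContinuousLinearMap.smulRight (1 : ℝ →L[ℝ] ℝ) (Pi.single i 1 : Fin 4 → ℝ) (u y i) := by
    intro u
    funext y k
    simp [Finset.sum_apply, Pi.single_apply]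
  rw [hs u, hs v]
  exact Agree.sum
    (fun i _ => (hc i).clm _ (contDiffAt_coord hu i) (contDiffAt_coord hv i))
    (fun i _ => (ContinuousLinearMap.contDiff _).contDiffAt.comp x (contDiffAt_coord hu i))
    (fun i _ => (ContinuousLinearMap.contDiff _).contDiffAt.comp x (contDiffAt_coord hv i))

/-! ### The jet of a Taylor polynomial -/

/-- Products of one-variable functions keep this shape under `∂_j`, which reduces the jets of
monomials to one-variable derivatives. -/
theorem pderiv_prod {g : Fin 5 → ℝ → ℝ} (hg : ∀ j, ContDiff ℝ ∞ (g j)) (j : Fin 5) :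
    pderiv j (fun y => ∏ l, g l (y l))
      = fun y => ∏ l, Function.update g j (deriv (g j)) l (y l) := by
  funext y
  have hd : ∀ l, HasFDerivAt (fun y : M => g l (y l))
      (deriv (g l) (y l) • ContinuousLinearMap.proj (R := ℝ) (φ := fun _ : Fin 5 => ℝ) l) y :=
    fun l => HasDerivAt.comp_hasFDerivAt (h₂ := g l) y
      (((hg l).differentiable (by simp)) (y l)).hasDerivAt (hasFDerivAt_apply l y)
  have h := HasFDerivAt.finsetProd (u := Finset.univ) fun l _ => hd l
  have e : (fun y : M => ∏ l, g l (y l)) = (fun y => ∏ l ∈ Finset.univ, g l (y l)) := rfl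
  rw [pderiv, e, h.fderiv]
  simp only [sum_apply, smul_apply,
    ContinuousLinearMap.proj_apply, smul_eq_mul]
  rw [Finset.sum_eq_single j (fun l _ hl => by simp [hl]) (by simp),
    ← Finset.mul_prod_erase Finset.univ _ (Finset.mem_univ j), mul_comm]
  simp only [Function.update_self, Pi.single_eq_same, mul_one]
  congr 1
  refine Finset.prod_congr rfl fun l hl => ?_
  rw [Function.update_of_ne (Finset.ne_of_mem_erase hl)]

theorem contDiff_deriv_iterate {g : ℝ → ℝ} (hg : ContDiff ℝ ∞ g) (k : ℕ) :
    ContDiff ℝ ∞ (deriv^[k] g) := by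
  induction k generalizing g with
  | zero => exact hg
  | succ k ih => exact ih (contDiff_infty_iff_deriv.1 hg).2

theorem contDiff_update {g : Fin 5 → ℝ → ℝ} (hg : ∀ j, ContDiff ℝ ∞ (g j)) (j : Fin 5)
    {h : ℝ → ℝ} (hh : ContDiff ℝ ∞ h) (l : Fin 5) : ContDiff ℝ ∞ (Function.update g j h l) := by
  by_cases hl : l = j
  · subst hl; simpa using hh
  · simpa [Function.update_of_ne hl] using hg l

theorem pderiv_iterate_prod {g : Fin 5 → ℝ → ℝ} (hg : ∀ j, ContDiff ℝ ∞ (g j)) (j : Fin 5)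
    (k : ℕ) :
    (pderiv j)^[k] (fun y => ∏ l, g l (y l))
      = fun y => ∏ l, Function.update g j (deriv^[k] (g j)) l (y l) := by
  induction k generalizing g with
  | zero => simp
  | succ k ih =>
    rw [Function.iterate_succ_apply, pderiv_prod hg,
      ih (contDiff_update hg j (contDiff_infty_iff_deriv.1 (hg j)).2)]
    simp

theorem iterDeriv_prod {g : Fin 5 → ℝ → ℝ} (hg : ∀ j, ContDiff ℝ ∞ (g j)) (σ : Fin 5 → ℕ) :
    iterDeriv σ (fun y => ∏ l, g l (y l)) = fun y => ∏ l, deriv^[σ l] (g l) (y l) := by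
  have hi := fun j => contDiff_deriv_iterate (hg j) (σ j)
  have c4 := contDiff_update hg 4 (hi 4)
  have c3 := contDiff_update c4 3 (hi 3)
  have c2 := contDiff_update c3 2 (hi 2)
  have c1 := contDiff_update c2 1 (hi 1)
  rw [iterDeriv, pderiv_iterate_prod hg, pderiv_iterate_prod c4]
  simp only [ne_eq, Fin.reduceEq, not_false_eq_true, Function.update_of_ne]
  rw [pderiv_iterate_prod c3]
  simp only [ne_eq, Fin.reduceEq, not_false_eq_true, Function.update_of_ne]
  rw [pderiv_iterate_prod c2]
  simp only [ne_eq, Fin.reduceEq, not_false_eq_true, Function.update_of_ne]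
  rw [pderiv_iterate_prod c1]
  simp only [ne_eq, Fin.reduceEq, not_false_eq_true, Function.update_of_ne]
  funext y
  simp [Fin.prod_univ_succ, Function.update]

theorem pderiv_iterate_sum {ι : Type*} {s : Finset ι} (c : ι → ℝ) {f : ι → M → ℝ}
    (hf : ∀ i, ContDiff ℝ ∞ (f i)) (j : Fin 5) (k : ℕ) :
    (∀ i, ContDiff ℝ ∞ ((pderiv j)^[k] (f i))) ∧
    (pderiv j)^[k] (fun y => ∑ i ∈ s, c i * f i y)
      = fun y => ∑ i ∈ s, c i * (pderiv j)^[k] (f i) y := by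
  induction k generalizing f with
  | zero => exact ⟨hf, rfl⟩
  | succ k ih =>
    have h1 : pderiv j (fun y => ∑ i ∈ s, c i * f i y)
        = fun y => ∑ i ∈ s, c i * pderiv j (f i) y := by
      funext y
      have hd : ∀ i ∈ s, HasFDerivAt (fun y => c i * f i y) (c i • fderiv ℝ (f i) y) y :=
        fun i _ => (((hf i).differentiable (by simp)) y).hasFDerivAt.const_mul (c i)
      have h := HasFDerivAt.fun_sum hd
      rw [pderiv, h.fderiv]
      simp [pderiv]
    have := ih fun i => contDiff_iff_contDiffAt.2 fun x =>
      ContDiffAt.pderiv (m := ∞) (hf i).contDiffAt (by simp) j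
    rw [Function.iterate_succ_apply, h1]
    exact this

theorem iterDeriv_sum {ι : Type*} {s : Finset ι} (c : ι → ℝ) {f : ι → M → ℝ}
    (hf : ∀ i, ContDiff ℝ ∞ (f i)) (σ : Fin 5 → ℕ) :
    iterDeriv σ (fun y => ∑ i ∈ s, c i * f i y) = fun y => ∑ i ∈ s, c i * iterDeriv σ (f i) y := by
  obtain ⟨c4, e4⟩ := pderiv_iterate_sum (s := s) c hf 4 (σ 4)
  obtain ⟨c3, e3⟩ := pderiv_iterate_sum (s := s) c c4 3 (σ 3)
  obtain ⟨c2, e2⟩ := pderiv_iterate_sum (s := s) c c3 2 (σ 2)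
  obtain ⟨c1, e1⟩ := pderiv_iterate_sum (s := s) c c2 1 (σ 1)
  obtain ⟨c0, e0⟩ := pderiv_iterate_sum (s := s) c c1 0 (σ 0)
  rw [iterDeriv, e4, e3, e2, e1, e0]
  rfl

theorem deriv_iterate_monomial (x : ℝ) (k m : ℕ) :
    deriv^[k] (fun t => (t - x) ^ m / (Nat.factorial m : ℝ)) x = if k = m then 1 else 0 := by
  induction k generalizing m with
  | zero => cases m <;> simp
  | succ k ih =>
    rw [Function.iterate_succ_apply]
    cases m with
    | zero =>
      have h0 : deriv (fun t : ℝ => (t - x) ^ 0 / (Nat.factorial 0 : ℝ)) = fun _ => 0 := by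
        funext t; simp
      have h1 : deriv^[k] (fun _ : ℝ => (0 : ℝ)) = fun _ => 0 :=
        Function.iterate_fixed (by funext t; simp) k
      rw [h0, h1]
      simp
    | succ m =>
      have h0 : deriv (fun t : ℝ => (t - x) ^ (m + 1) / (Nat.factorial (m + 1) : ℝ))
          = fun t => (t - x) ^ m / (Nat.factorial m : ℝ) := by
        funext t
        have h := (((hasDerivAt_id t).sub_const x).pow (m + 1)).div_const
          (Nat.factorial (m + 1) : ℝ)
        refine h.deriv.trans ?_
        rw [Nat.factorial_succ]
        push_cast
        simp only [id, mul_one]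
        rw [mul_div_mul_left _ _ (by positivity)]
      rw [h0, ih]
      simp

/-- The monomials divided by factorials are dual to the `∂^σ` at the base point, so one term of the
sum survives. -/
theorem multiDeriv_taylor (θ : JetCoord) (σ : MultiIdx) (i : Fin 4) :
    multiDeriv σ (fun y => taylor θ y i) θ.1 = θ.2 σ i := by
  have hs : ∀ (τ : MultiIdx) (j : Fin 5), ContDiff ℝ ∞
      (fun t : ℝ => (t - θ.1 j) ^ (τ.1 j : ℕ) / (Nat.factorial (τ.1 j) : ℝ)) := by
    intro τ j
    exact ((contDiff_id.sub contDiff_const).pow _).div_const _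
  change iterDeriv (fun j => σ.1 j) (fun y => taylor θ y i) θ.1 = _
  have h1 := iterDeriv_sum (s := Finset.univ) (fun τ : MultiIdx => θ.2 τ i)
    (f := fun τ y => ∏ j, (y j - θ.1 j) ^ (τ.1 j : ℕ) / (Nat.factorial (τ.1 j) : ℝ))
    (fun τ => contDiff_prod fun j _ => (hs τ j).comp (contDiff_apply ℝ ℝ j)) fun j => σ.1 j
  refine (congrFun h1 θ.1).trans ?_
  rw [Finset.sum_eq_single σ]
  · have h2 := congrFun (iterDeriv_prod (hs σ) fun j => σ.1 j) θ.1
    rw [h2]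
    simp [deriv_iterate_monomial]
  · intro τ _ hτ
    have h2 := congrFun (iterDeriv_prod (hs τ) fun j => σ.1 j) θ.1
    obtain ⟨j, hj⟩ : ∃ j, σ.1 j ≠ τ.1 j := by
      by_contra! hcon
      exact hτ (Subtype.ext (funext fun j => (hcon j).symm))
    rw [h2, Finset.prod_eq_zero (Finset.mem_univ j), mul_zero]
    rw [deriv_iterate_monomial, if_neg]
    exact fun h => hj (Fin.ext h)
  · simp

theorem taylor_self (θ : JetCoord) (i : Fin 4) :
    taylor θ θ.1 i = θ.2 MultiIdx.zero i := multiDeriv_taylor θ MultiIdx.zero i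

/-! ### The invariants as functions on the jet space -/

theorem contDiff_taylor {n : WithTop ℕ∞} :
    ContDiff ℝ n (fun e : JetCoord × M => taylor e.1 e.2) := by
  refine contDiff_pi.2 fun i => ?_
  unfold taylor
  refine ContDiff.sum fun σ _ => ?_
  refine ContDiff.mul (by fun_prop) (contDiff_prod fun j _ => ?_)
  exact ContDiff.div_const (by fun_prop) _

theorem contDiff_taylor_right (θ : JetCoord) {n : WithTop ℕ∞} : ContDiff ℝ n (taylor θ) :=
  contDiff_taylor.comp (contDiff_const.prodMk contDiff_id)

theorem hyp_taylor {θ : JetCoord} (hθ : θ ∈ J3) : Hyp (taylor θ) θ.1 := by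
  refine ⟨(contDiff_taylor_right θ).contDiffAt, ?_⟩
  rw [taylor_self, taylor_self]
  exact hθ

/-- Jet and point vary independently here, because the derivative is taken in the point alone; the
point is set to the base point only in `onJet`. -/
theorem contDiff_prol_taylor {E : Type*} [NormedAddCommGroup E] [NormedSpace ℝ E]
    {J : (M → Fin 4 → ℝ) → M → E}
    (h : ContDiff ℝ ω (fun e : JetCoord × M => J (taylor e.1) e.2)) :
    ContDiff ℝ ω (fun e : JetCoord × M => prol J (taylor e.1) e.2) := by
  refine h.prodMk ?_
  refine ContDiff.fderiv (f := fun e : JetCoord × M => J (taylor e.1)) (g := Prod.snd) (m := ω)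
    ?_ contDiff_snd (by simp)
  exact h.comp (contDiff_fst.fst.prodMk contDiff_snd)

theorem contDiff_J2_taylor : ContDiff ℝ ω (fun e : JetCoord × M => J2 (taylor e.1) e.2) :=
  contDiff_prol_taylor (contDiff_prol_taylor (contDiff_snd.prodMk contDiff_taylor))

set_option synthInstance.maxSize 10000 in
theorem contDiff_J3_taylor :
    ContDiff ℝ ω (fun e : JetCoord × M => prol J2 (taylor e.1) e.2) :=
  contDiff_prol_taylor contDiff_J2_taylor

/-- The function on the jet space given by an operator. -/
def onJet (T : (M → Fin 4 → ℝ) → M → ℝ) (θ : JetCoord) : ℝ := T (taylor θ) θ.1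

theorem isOpen_J3 : IsOpen J3 := isOpen_lt (by fun_prop) (by fun_prop)

/-- Supplies the connectedness required by the identity theorem. -/
theorem convex_J3 : Convex ℝ J3 := by
  intro θ hθ θ' hθ' a b ha hb hab
  simp only [J3, Set.mem_ofPred_eq, Prod.snd_add, Prod.smul_snd, Pi.add_apply, Pi.smul_apply,
    smul_eq_mul] at *
  -- The strict inequality needs a positive weight, so the weight `a = 0` is treated apart.
  rcases ha.eq_or_lt with rfl | ha
  · have : b = 1 := by linarith
    subst this; simpa using hθ'
  · have := mul_lt_mul_of_pos_left hθ ha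
    have := mul_le_mul_of_nonneg_left hθ'.le hb
    linarith

/-- An operator depending on jets gives an analytic function on the jet space. -/
theorem Rep.contDiffAt_onJet {E : Type*} [NormedAddCommGroup E] [NormedSpace ℝ E]
    {J : (M → Fin 4 → ℝ) → M → E} {T : (M → Fin 4 → ℝ) → M → ℝ} (h : Rep J T)
    (hJ : ContDiff ℝ ω (fun e : JetCoord × M => J (taylor e.1) e.2)) {θ : JetCoord}
    (hθ : θ ∈ J3) : ContDiffAt ℝ ω (onJet T) θ := by
  obtain ⟨G, hG⟩ := h
  have h1 : onJet T =ᶠ[nhds θ] fun θ => G (J (taylor θ) θ.1) := by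
    filter_upwards [isOpen_J3.mem_nhds hθ] with θ' hθ'
    exact (hG _ _ (hyp_taylor hθ')).2
  refine ContDiffAt.congr_of_eventuallyEq ?_ h1
  exact ContDiffAt.comp θ (f := fun θ : JetCoord => J (taylor θ) θ.1) (hG _ _ (hyp_taylor hθ)).1
    (hJ.comp (contDiff_id.prodMk contDiff_fst)).contDiffAt

set_option synthInstance.maxSize 10000 in
theorem contDiffAt_basicOp (i : Fin 6) {θ : JetCoord} (hθ : θ ∈ J3) :
    ContDiffAt ℝ ω (onJet (basicOp i)) θ :=
  (rep_basicOp i).contDiffAt_onJet contDiff_J3_taylor hθ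

theorem Rep.eq_of_eq {E F : Type*} [NormedAddCommGroup E] [NormedSpace ℝ E]
    [NormedAddCommGroup F] [NormedSpace ℝ F]
    {J : (M → Fin 4 → ℝ) → M → E} {T : (M → Fin 4 → ℝ) → M → F} (h : Rep J T)
    {u v : M → Fin 4 → ℝ} {x : M} (hu : Hyp u x) (hv : Hyp v x) (huv : J u x = J v x) :
    T u x = T v x := by
  obtain ⟨G, hG⟩ := h
  rw [(hG u x hu).2, (hG v x hv).2, huv]

/-- The invariants in terms of the basic operators. -/
theorem invOfEq_eq (u : M → Fin 4 → ℝ) (x : M) (k : Fin 5) :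
    invOfEq u k x = ![basicOp 1 u x / basicOp 0 u x, basicOp 1 u x / basicOp 2 u x,
      (basicOp 3 u x / |basicOp 0 u x| ^ (3 / 2 : ℝ)) ^ 2,
      (basicOp 5 u x / |basicOp 0 u x| ^ (3 / 2 : ℝ)) ^ 2,
      (basicOp 4 u x / |basicOp 0 u x| ^ (3 / 2 : ℝ)) ^ 2] k := by
  fin_cases k <;> rfl

-- The section and the Taylor polynomial of its jet agree to order three, so the six basic operators
-- take the same values on both.
set_option synthInstance.maxSize 10000 in
theorem invOfEq_eq_inv_jet3 {u : M → Fin 4 → ℝ} {x : M} (hu : ContDiffAt ℝ ∞ u x)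
    (h : u x 1 < u x 2) (k : Fin 5) : invOfEq u k x = inv k (jet3 u x) := by
  have hJ : jet3 u x ∈ J3 := h
  have ht : ContDiffAt ℝ ∞ (taylor (jet3 u x)) x := (contDiff_taylor_right _).contDiffAt
  have ha : Agree 3 u (taylor (jet3 u x)) x :=
    agree_of_multiDeriv le_rfl hu ht fun σ _ i => (multiDeriv_taylor (jet3 u x) σ i).symm
  have hb : ∀ i, basicOp i u x = basicOp i (taylor (jet3 u x)) x := fun i =>
    (rep_basicOp i).eq_of_eq ⟨by exact_mod_cast contDiffAt_infty.1 hu 3, h⟩ (hyp_taylor hJ)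
      (ha.J3_eq hu ht)
  change _ = invOfEq (taylor (jet3 u x)) k x
  simp only [invOfEq_eq, hb]

theorem inv_eq_of_order_two (k : Fin 5) (hk : k = 0 ∨ k = 1) {θ θ' : JetCoord} (hθ : θ ∈ J3)
    (hθ' : θ' ∈ J3) (h1 : θ.1 = θ'.1) (h2 : ∀ σ : MultiIdx, σ.order ≤ 2 → θ.2 σ = θ'.2 σ) :
    inv k θ = inv k θ' := by
  have ct : ∀ θ : JetCoord, ContDiffAt ℝ ∞ (taylor θ) θ'.1 :=
    fun θ => (contDiff_taylor_right _).contDiffAt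
  have ha : Agree 2 (taylor θ) (taylor θ') θ'.1 := by
    refine agree_of_multiDeriv (by norm_num) (ct _) (ct _) fun σ hσ i => ?_
    rw [multiDeriv_taylor θ', ← h1, multiDeriv_taylor θ, h2 σ hσ]
  have hJ := ha.J2_eq (ct _) (ct _)
  have hy : Hyp (taylor θ) θ'.1 := h1 ▸ hyp_taylor hθ
  have hy' := hyp_taylor hθ'
  have e1 := rep_Lam1.eq_of_eq hy hy' hJ
  have e2 := rep_Lam2.eq_of_eq hy hy' hJ
  have e3 := rep_Lam12.eq_of_eq hy hy' hJ
  rcases hk with rfl | rfl <;> simp [inv, invOfEq, h1, e1, e2, e3]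

/-! ### A family of equations with explicit invariants -/

theorem Rep.differentiableAt {E F : Type*} [NormedAddCommGroup E] [NormedSpace ℝ E]
    [NormedAddCommGroup F] [NormedSpace ℝ F]
    {J : (M → Fin 4 → ℝ) → M → E} {T : (M → Fin 4 → ℝ) → M → F} (h : Rep J T)
    {u : M → Fin 4 → ℝ} {y : M} (hu : Hyp u y) (hJ : DifferentiableAt ℝ (J u) y) :
    DifferentiableAt ℝ (T u) y := by
  obtain ⟨G, hG⟩ := h
  have h1 : T u =ᶠ[nhds y] G ∘ J u := by
    filter_upwards [hu.eventually] with y' hy'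
    exact (hG u y' hy').2
  exact (((hG u y hu).1.differentiableAt (by simp)).comp y hJ).congr_of_eventuallyEq h1

theorem lieBracket_X1_X2 (u : M → Fin 4 → ℝ) (y : M) (hu : DifferentiableAt ℝ u y) :
    VectorField.lieBracket ℝ (X1 u) (X2 u) y = ![0, 0, u y 1 - u y 2,
      along (X1 u) (fun y => u y 2) y - along (X2 u) (fun y => u y 0) y,
      along (X1 u) (fun y => u y 3) y - along (X2 u) (fun y => u y 1) y] := by
  have hd : ∀ i, DifferentiableAt ℝ (fun y => u y i) y := fun i => differentiableAt_pi.1 hu i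
  have f1 : fderiv ℝ (X1 u) y (X2 u y) = _ := fderiv_frame 1 0 3 (hd 0) (hd 1) _
  have f2 : fderiv ℝ (X2 u) y (X1 u y) = _ := fderiv_frame 0 1 4 (hd 2) (hd 3) _
  rw [VectorField.lieBracket, f1, f2]
  funext i
  fin_cases i <;> simp [X1, X2, along]

/-- A function quadratic in `x, y` with coefficients affine in `z`. -/
def quad (c p p' q q' : ℝ) (y : M) : ℝ :=
  c + ((p + p' * y 2) * y 0 ^ 2 + (q + q' * y 2) * y 1 ^ 2) / 2

theorem differentiable_quad (c p p' q q' : ℝ) : Differentiable ℝ (quad c p p' q q') := by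
  unfold quad; fun_prop

/-- Computed as the derivative at `t = 0` of the one-variable polynomial `t ↦ quad (y + t v)`. -/
theorem fderiv_quad (c p p' q q' : ℝ) (y v : M) : fderiv ℝ (quad c p p' q q') y v
    = (p + p' * y 2) * y 0 * v 0 + (q + q' * y 2) * y 1 * v 1
      + (p' * y 0 ^ 2 + q' * y 1 ^ 2) / 2 * v 2 := by
  have h1 : HasDerivAt (fun t : ℝ => y + t • v) v 0 := by
    simpa using ((hasDerivAt_id (0 : ℝ)).smul_const v).const_add y
  have h2 : HasFDerivAt (quad c p p' q q') (fderiv ℝ (quad c p p' q q') y) (y + (0 : ℝ) • v) := by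
    simpa using (differentiable_quad c p p' q q' y).hasFDerivAt
  have h3 := h2.comp_hasDerivAt (0 : ℝ) h1
  have hl : ∀ i, HasDerivAt (fun t : ℝ => y i + t * v i) (v i) 0 := by
    intro i
    simpa using ((hasDerivAt_id (0 : ℝ)).mul_const (v i)).const_add (y i)
  have h4 := ((((((hl 2).const_mul p').const_add p).mul ((hl 0).pow 2)).add
    ((((hl 2).const_mul q').const_add q).mul ((hl 1).pow 2))).div_const 2).const_add c
  refine (h3.unique h4).trans ?_
  simp
  ring

/-- The family of sections. -/
def exSec (s : Fin 6 → ℝ) : M → Fin 4 → ℝ := fun y =>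
  ![0, quad 0 (s 0) (s 3) (s 2) (s 5) y, quad 1 1 0 (s 1) (s 4) y, 0]

theorem contDiff_exSec (s : Fin 6 → ℝ) : ContDiff ℝ 3 (exSec s) := by
  refine contDiff_pi.2 fun i => ?_
  fin_cases i <;> simp [exSec, quad] <;> fun_prop

/-- The points of the `z`-axis. -/
def zPt (z : ℝ) : M := ![0, 0, z, 0, 0]

theorem hyp_exSec (s : Fin 6 → ℝ) (z : ℝ) : Hyp (exSec s) (zPt z) :=
  ⟨(contDiff_exSec s).contDiffAt, by simp [exSec, quad, zPt]⟩

/-- As `u¹ = u⁴ = 0`, only `f = u²` and `g = u³` are differentiated. Neither involves `p, q`, so all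
four fields act on them through `∂x + p ∂z` and `∂y + q ∂z`; these derivatives are `fx, fy, gx, gy`.
-/
theorem X5_exSec (s : Fin 6 → ℝ) (y : M) :
    let f := quad 0 (s 0) (s 3) (s 2) (s 5) y
    let g := quad 1 1 0 (s 1) (s 4) y
    let fx := (s 0 + s 3 * y 2) * y 0 + (s 3 * y 0 ^ 2 + s 5 * y 1 ^ 2) / 2 * y 3
    let fy := (s 2 + s 5 * y 2) * y 1 + (s 3 * y 0 ^ 2 + s 5 * y 1 ^ 2) / 2 * y 4
    let gx := y 0 + s 4 * y 1 ^ 2 / 2 * y 3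
    let gy := (s 1 + s 4 * y 2) * y 1 + s 4 * y 1 ^ 2 / 2 * y 4
    let l := (fy + gy) / (f - g)
    let m := (fx + gx) / (f - g)
    X5 (exSec s) y = ![l, m, l * y 3 + m * y 4 + (f - g), m * g + gx, l * f - fy] := by
  intro f g fx fy gx gy l m
  have h0 : (fun y => exSec s y 0) = fun _ => 0 := rfl
  have h1 : (fun y => exSec s y 1) = quad 0 (s 0) (s 3) (s 2) (s 5) := rfl
  have h2 : (fun y => exSec s y 2) = quad 1 1 0 (s 1) (s 4) := rfl
  have h3 : (fun y => exSec s y 3) = fun _ => 0 := rfl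
  have e1 : lam1 (exSec s) y = l := by
    simp only [lam1, along, h1, h2, h3, fderiv_quad, X1, X2, X3, X4]
    simp [exSec, l, f, g, fy, gy]
  have e2 : lam2 (exSec s) y = m := by
    simp only [lam2, along, h1, h2, h0, fderiv_quad, X1, X2, X3, X4]
    simp [exSec, m, f, g, fx, gx]
    ring
  rw [X5, e1, e2, lieBracket_X1_X2 _ _ ((contDiff_exSec s).differentiable (by simp) y)]
  simp only [along, h0, h1, h2, h3, fderiv_quad]
  funext i
  fin_cases i <;> simp [X1, X2, exSec, f, g, fy, gx] <;> ring

theorem X5_exSec_zPt (s : Fin 6 → ℝ) (z : ℝ) : X5 (exSec s) (zPt z) = ![0, 0, -1, 0, 0] := by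
  rw [X5_exSec]
  simp [zPt, quad]

/-- The explicit `X₅` is restricted to the line `zPt z + t v`. With `v 2 = 0` the coordinate `z` is
constant on it, and at `t = 0` the denominator `f - g` equals `-1`. -/
theorem fderiv_X5_exSec (s : Fin 6 → ℝ) (z : ℝ) (v : M) (hv : v 2 = 0) :
    fderiv ℝ (X5 (exSec s)) (zPt z) v =
      ![-(s 1 + s 4 * z + (s 2 + s 5 * z)) * v 1, -(1 + (s 0 + s 3 * z)) * v 0, 0,
        -(s 0 + s 3 * z) * v 0, -(s 2 + s 5 * z) * v 1] := by
  have hd : DifferentiableAt ℝ (X5 (exSec s)) (zPt z) :=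
    rep_X5.differentiableAt (hyp_exSec s z) (Hyp.differentiableAt_J1 _ _ (hyp_exSec s z))
  have h1 : HasDerivAt (fun t : ℝ => zPt z + t • v) v 0 := by
    simpa using ((hasDerivAt_id (0 : ℝ)).smul_const v).const_add (zPt z)
  have h2 : HasFDerivAt (X5 (exSec s)) (fderiv ℝ (X5 (exSec s)) (zPt z))
      (zPt z + (0 : ℝ) • v) := by
    simpa using hd.hasFDerivAt
  have h3 := h2.comp_hasDerivAt (0 : ℝ) h1
  -- Every `quad` is stationary on the `z`-axis, since `z` occurs only multiplied by `x²` or `y²`.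
  have hq : ∀ c p p' q q', HasDerivAt (fun t : ℝ => quad c p p' q q' (zPt z + t • v)) 0 0 := by
    intro c p p' q q'
    have := ((differentiable_quad c p p' q q' (zPt z)).hasFDerivAt)
    have h2 : HasFDerivAt (quad c p p' q q') (fderiv ℝ (quad c p p' q q') (zPt z))
        (zPt z + (0 : ℝ) • v) := by simpa using this
    have h3 := h2.comp_hasDerivAt (0 : ℝ) h1
    exact h3.congr_deriv (by simp [fderiv_quad, zPt])
  -- The shape of `fx, fy, gx, gy` along the line: a linear term plus a cubic one, which does not
  -- contribute.
  have hm : ∀ a c d e : ℝ, HasDerivAt (fun t : ℝ => a * (t * c) + d * t ^ 2 * (t * e)) (a * c) 0 := by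
    intro a c d e
    have hi := hasDerivAt_id (0 : ℝ)
    have := ((hi.mul_const c).const_mul a).add (((hi.pow 2).const_mul d).mul (hi.mul_const e))
    exact this.congr_deriv (by simp)
  have hfg := (hq 0 (s 0) (s 3) (s 2) (s 5)).sub (hq 1 1 0 (s 1) (s 4))
  have hfx := hm (s 0 + s 3 * z) (v 0) ((s 3 * v 0 ^ 2 + s 5 * v 1 ^ 2) / 2) (v 3)
  have hfy := hm (s 2 + s 5 * z) (v 1) ((s 3 * v 0 ^ 2 + s 5 * v 1 ^ 2) / 2) (v 4)
  have hgx := hm 1 (v 0) (s 4 * v 1 ^ 2 / 2) (v 3)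
  have hgy := hm (s 1 + s 4 * z) (v 1) (s 4 * v 1 ^ 2 / 2) (v 4)
  have hl := (hfy.add hgy).div hfg (by simp [zPt, quad])
  have hn := (hfx.add hgx).div hfg (by simp [zPt, quad])
  have hlin : ∀ c : ℝ, HasDerivAt (fun t : ℝ => t * c) c 0 := fun c => by
    simpa using (hasDerivAt_id (0 : ℝ)).mul_const c
  have k2 := ((hl.mul (hlin (v 3))).add (hn.mul (hlin (v 4)))).add hfg
  have k3 := (hn.mul (hq 1 1 0 (s 1) (s 4))).add hgx
  have k4 := (hl.mul (hq 0 (s 0) (s 3) (s 2) (s 5))).sub hfy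
  refine h3.unique (hasDerivAt_pi.2 fun i => ?_)
  simp only [Function.comp_def, X5_exSec]
  fin_cases i
  · refine (hl.congr_deriv ?_).congr_of_eventuallyEq (Filter.Eventually.of_forall fun t => ?_)
    · simp [zPt, quad]; ring
    · simp [zPt, hv]; ring
  · refine (hn.congr_deriv ?_).congr_of_eventuallyEq (Filter.Eventually.of_forall fun t => ?_)
    · simp [zPt, quad]; ring
    · simp [zPt, hv]; ring
  · refine (k2.congr_deriv ?_).congr_of_eventuallyEq (Filter.Eventually.of_forall fun t => ?_)
    · simp [zPt, quad]
    · simp [zPt, hv]; ring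
  · refine (k3.congr_deriv ?_).congr_of_eventuallyEq (Filter.Eventually.of_forall fun t => ?_)
    · simp [zPt, quad]; ring
    · simp [zPt, hv]; ring
  · refine (k4.congr_deriv ?_).congr_of_eventuallyEq (Filter.Eventually.of_forall fun t => ?_)
    · simp [zPt, quad]; ring
    · simp [zPt, hv]; ring

/-- Only `D X₅ (X_j)` contributes: `D X_j` is applied to `X₅ = -∂z`, along which the entries of
`X_j` are stationary. -/
theorem lieBracket_frame_exSec (s : Fin 6 → ℝ) (z : ℝ) {g h : M → ℝ} (a b : ℝ) (j : Fin 5)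
    (hj : j ≠ 2) (hg : DifferentiableAt ℝ g (zPt z)) (hh : DifferentiableAt ℝ h (zPt z))
    (hg0 : fderiv ℝ g (zPt z) ![0, 0, -1, 0, 0] = 0)
    (hh0 : fderiv ℝ h (zPt z) ![0, 0, -1, 0, 0] = 0) :
    VectorField.lieBracket ℝ (fun y => (![a, b, y j, g y, h y] : M)) (X5 (exSec s)) (zPt z)
      = ![-(s 1 + s 4 * z + (s 2 + s 5 * z)) * b, -(1 + (s 0 + s 3 * z)) * a, 0,
        -(s 0 + s 3 * z) * a, -(s 2 + s 5 * z) * b] := by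
  have h1 : zPt z j = 0 := by fin_cases j <;> simp_all [zPt]
  have h2 : (![0, 0, -1, 0, 0] : M) j = 0 := by fin_cases j <;> simp_all
  rw [VectorField.lieBracket, X5_exSec_zPt, fderiv_frame a b j hg hh,
    fderiv_X5_exSec s z _ (by simpa using h1), hg0, hh0, h2]
  funext i
  fin_cases i <;> simp

theorem b_exSec (s : Fin 6 → ℝ) (z : ℝ) :
    let A := s 0 + s 3 * z
    let B := s 1 + s 4 * z
    let C := s 2 + s 5 * z
    let b' := fun i j => b (exSec s) i j 4 (zPt z)
    (b' 0 0 = 0 ∧ b' 1 0 = -A ∧ b' 2 0 = 0 ∧ b' 3 0 = -1) ∧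
    (b' 0 1 = -B ∧ b' 1 1 = 0 ∧ b' 2 1 = -C ∧ b' 3 1 = 0) ∧
    (b' 0 2 = 0 ∧ b' 1 2 = -A ∧ b' 2 2 = 0 ∧ b' 3 2 = -1) ∧
    (b' 0 3 = -B ∧ b' 1 3 = 0 ∧ b' 2 3 = -C ∧ b' 3 3 = 0) := by
  intro A B C b'
  have hd : ∀ i, DifferentiableAt ℝ (fun y => exSec s y i) (zPt z) := fun i =>
    differentiableAt_pi.1 ((contDiff_exSec s).differentiable (by simp) (zPt z)) i
  have hy := hyp_exSec s z
  have hz : ∀ i, fderiv ℝ (fun y => exSec s y i) (zPt z) ![0, 0, -1, 0, 0] = 0 := by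
    intro i
    fin_cases i
    · simp [exSec]
    · exact (fderiv_quad _ _ _ _ _ _ _).trans (by simp [zPt])
    · exact (fderiv_quad _ _ _ _ _ _ _).trans (by simp [zPt])
    · simp [exSec]
  have v0 := lieBracket_frame_exSec s z 1 0 3 (by decide) (hd 0) (hd 1) (hz 0) (hz 1)
  have v1 := lieBracket_frame_exSec s z 0 1 4 (by decide) (hd 2) (hd 3) (hz 2) (hz 3)
  have v2 := lieBracket_frame_exSec s z 1 0 3 (by decide) (hd 0) (hd 2) (hz 0) (hz 2)
  have v3 := lieBracket_frame_exSec s z 0 1 4 (by decide) (hd 1) (hd 3) (hz 1) (hz 3)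
  have w0 := (sum_b_smul (exSec s) (zPt z) hy.differentiableAt hy.2 0 4).symm.trans v0
  have w1 := (sum_b_smul (exSec s) (zPt z) hy.differentiableAt hy.2 1 4).symm.trans v1
  have w2 := (sum_b_smul (exSec s) (zPt z) hy.differentiableAt hy.2 2 4).symm.trans v2
  have w3 := (sum_b_smul (exSec s) (zPt z) hy.differentiableAt hy.2 3 4).symm.trans v3
  -- On the `z`-axis `X₁ = ∂x`, `X₂ = ∂y + ∂p`, `X₃ = ∂x + ∂q`, `X₄ = ∂y`, `X₅ = -∂z`, so
  -- coefficients are read off from the entries `0, 1, 3, 4`.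
  have key : ∀ (c : Fin 5 → ℝ) (V : M), ∑ i, c i • frame (exSec s) i (zPt z) = V →
      c 0 + c 2 = V 0 ∧ c 1 + c 3 = V 1 ∧ c 1 = V 3 ∧ c 2 = V 4 := by
    intro c V hV
    have e := congrFun hV
    have e0 := e 0
    have e1 := e 1
    have e3 := e 3
    have e4 := e 4
    simp only [Finset.sum_apply, Pi.smul_apply, frame, Fin.sum_univ_succ, Fin.succ_zero_eq_one,
      Matrix.cons_val, Fin.succ_one_eq_two, Fin.reduceSucc, X5_exSec_zPt, smul_eq_mul,
      Finset.univ_eq_empty, Finset.sum_empty] at e0 e1 e3 e4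
    simp [X1, X2, X3, X4, exSec, quad, zPt] at e0 e1 e3 e4
    exact ⟨by linarith, by linarith, by linarith, by linarith⟩
  obtain ⟨p0, p1, p2, p3⟩ := key _ _ w0
  obtain ⟨q0, q1, q2, q3⟩ := key _ _ w1
  obtain ⟨r0, r1, r2, r3⟩ := key _ _ w2
  obtain ⟨t0, t1, t2, t3⟩ := key _ _ w3
  simp only [Matrix.cons_val] at p0 p1 p2 p3 q0 q1 q2 q3 r0 r1 r2 r3 t0 t1 t2 t3
  refine ⟨⟨?_, ?_, ?_, ?_⟩, ⟨?_, ?_, ?_, ?_⟩, ⟨?_, ?_, ?_, ?_⟩, ⟨?_, ?_, ?_, ?_⟩⟩ <;>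
    simp only [b', A, B, C] <;> linarith

theorem Lam_exSec (s : Fin 6 → ℝ) (z : ℝ) :
    Lam1 (exSec s) (zPt z) = (s 0 + s 3 * z) * (s 1 + s 4 * z) ∧
    Lam12 (exSec s) (zPt z) = s 1 + s 4 * z + (s 0 + s 3 * z) * (s 2 + s 5 * z) ∧
    Lam2 (exSec s) (zPt z) = s 2 + s 5 * z ∧ Bsum (exSec s) (zPt z) = 0 := by
  obtain ⟨⟨a0, a1, a2, a3⟩, ⟨b0, b1, b2, b3⟩, ⟨c0, c1, c2, c3⟩, ⟨d0, d1, d2, d3⟩⟩ := b_exSec s z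
  refine ⟨?_, ?_, ?_, ?_⟩
  · simp only [Lam1, c0, c1, d0, d1]; ring
  · simp only [Lam12, a2, a3, b2, b3, c0, c1, d0, d1]; ring
  · simp only [Lam2, a2, a3, b2, b3]; ring
  · simp only [Bsum, a0, b1, c2, d3]; ring

/-- As `B = 0` and `X₅ = -∂z`, the numerator is minus the `z`-derivative; this is why the `Λ`'s are
computed along the whole axis. -/
theorem numer_exSec {L : (M → Fin 4 → ℝ) → M → ℝ} (hL : Rep J2 L) (s : Fin 6 → ℝ) {l : ℝ → ℝ}
    {l' : ℝ} (h : ∀ z, L (exSec s) (zPt z) = l z) (hl : HasDerivAt l l' 0) :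
    numer L (exSec s) (zPt 0) = -l' := by
  have hd : DifferentiableAt ℝ (L (exSec s)) (zPt 0) :=
    hL.differentiableAt (hyp_exSec s 0) (Hyp.differentiableAt_J2 _ _ (hyp_exSec s 0))
  have hz : HasDerivAt zPt ![0, 0, 1, 0, 0] 0 := by
    refine hasDerivAt_pi.2 fun i => ?_
    fin_cases i <;> simp [zPt, hasDerivAt_const, hasDerivAt_id']
  have h1 := (hd.hasFDerivAt.comp_hasDerivAt (0 : ℝ) hz).congr_of_eventuallyEq
    (f₁ := l) (Filter.Eventually.of_forall fun z => (h z).symm)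
  have h2 : (![0, 0, -1, 0, 0] : M) = -![0, 0, 1, 0, 0] := by simp
  rw [numer, (Lam_exSec s 0).2.2.2, along, X5_exSec_zPt, h2, map_neg, h1.unique hl]
  simp

/-- The values of the basic operators on the family. -/
def exVal (s : Fin 6 → ℝ) : Fin 6 → ℝ :=
  ![s 0 * s 1, s 1 + s 0 * s 2, s 2, -(s 3 * s 1 + s 0 * s 4),
    -(s 4 + (s 3 * s 2 + s 0 * s 5)), -s 5]

theorem basicOp_exSec (s : Fin 6 → ℝ) (i : Fin 6) : basicOp i (exSec s) 0 = exVal s i := by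
  have h0 : (0 : M) = zPt 0 := by funext k; fin_cases k <;> simp [zPt]
  have hA : ∀ a c : ℝ, HasDerivAt (fun z => a + c * z) c 0 := fun a c => by
    simpa using ((hasDerivAt_id (0 : ℝ)).const_mul c).const_add a
  rw [h0]
  fin_cases i
  · exact (Lam_exSec s 0).1.trans (by simp [exVal])
  · exact (Lam_exSec s 0).2.1.trans (by simp [exVal])
  · exact (Lam_exSec s 0).2.2.1.trans (by simp [exVal])
  · refine (numer_exSec rep_Lam1 s (fun z => (Lam_exSec s z).1)
      ((hA (s 0) (s 3)).mul (hA (s 1) (s 4)))).trans (by simp [exVal])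
  · refine (numer_exSec rep_Lam12 s (fun z => (Lam_exSec s z).2.1)
      ((hA (s 1) (s 4)).add ((hA (s 0) (s 3)).mul (hA (s 2) (s 5))))).trans (by simp [exVal])
  · refine (numer_exSec rep_Lam2 s (fun z => (Lam_exSec s z).2.2.1)
      (hA (s 2) (s 5))).trans (by simp [exVal])

/-! ### The family as an affine six-parameter family of jets -/

/-- The jet coordinate `uⁱ_σ` as a tangent direction to the jet space. -/
def jetDir (σ : MultiIdx) (i : Fin 4) : JetCoord := (0, Pi.single σ (Pi.single i 1))

/-- The multi-index of `∂x²`. -/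
def idxXX : MultiIdx := ⟨![2, 0, 0, 0, 0], by simp [Fin.sum_univ_succ]⟩

/-- The multi-index of `∂y²`. -/
def idxYY : MultiIdx := ⟨![0, 2, 0, 0, 0], by simp [Fin.sum_univ_succ]⟩

/-- The multi-index of `∂x²∂z`. -/
def idxXXZ : MultiIdx := ⟨![2, 0, 1, 0, 0], by simp [Fin.sum_univ_succ]⟩

/-- The multi-index of `∂y²∂z`. -/
def idxYYZ : MultiIdx := ⟨![0, 2, 1, 0, 0], by simp [Fin.sum_univ_succ]⟩

/-- The directions of the family of jets. -/
def exDir : Fin 6 → JetCoord :=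
  ![jetDir idxXX 1, jetDir idxYY 2, jetDir idxYY 1, jetDir idxXXZ 1, jetDir idxYYZ 2,
    jetDir idxYYZ 1]

/-- The jets at `0` of the family. -/
def exJet (s : Fin 6 → ℝ) : JetCoord :=
  (jetDir MultiIdx.zero 2 + jetDir idxXX 2) + ∑ i, s i • exDir i

theorem exJet_fst (s : Fin 6 → ℝ) : (exJet s).1 = 0 := by
  simp [exJet, jetDir, exDir, Fin.sum_univ_succ]

theorem taylor_exJet (s : Fin 6 → ℝ) : taylor (exJet s) = exSec s := by
  funext y i
  have hs : ∀ (τ : MultiIdx) (k : Fin 4) (m : MultiIdx → ℝ),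
      ∑ σ : MultiIdx, (Pi.single τ (Pi.single k 1) : MultiIdx → Fin 4 → ℝ) σ i * m σ
        = (Pi.single k 1 : Fin 4 → ℝ) i * m τ := by
    intro τ k m
    rw [Finset.sum_eq_single τ (fun σ _ h => by simp [Pi.single_eq_of_ne h]) (by simp)]
    simp
  have e : (exJet s).2 = (jetDir MultiIdx.zero 2).2 + (jetDir idxXX 2).2
      + (s 0 • (jetDir idxXX 1).2 + s 1 • (jetDir idxYY 2).2 + s 2 • (jetDir idxYY 1).2
        + s 3 • (jetDir idxXXZ 1).2 + s 4 • (jetDir idxYYZ 2).2 + s 5 • (jetDir idxYYZ 1).2) := by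
    simp [exJet, exDir, Fin.sum_univ_six]
  rw [taylor, exJet_fst, e]
  simp only [jetDir, Pi.add_apply, Pi.smul_apply, smul_eq_mul, add_mul, mul_assoc,
    Finset.sum_add_distrib, ← Finset.mul_sum, hs]
  simp only [Fin.prod_univ_five, idxXX, idxYY, idxXXZ, idxYYZ, MultiIdx.zero]
  fin_cases i <;> simp [exSec, quad, Nat.factorial] <;> ring

theorem onJet_exJet (s : Fin 6 → ℝ) (i : Fin 6) : onJet (basicOp i) (exJet s) = exVal s i := by
  rw [onJet, taylor_exJet, exJet_fst, basicOp_exSec]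

theorem exJet_mem (s : Fin 6 → ℝ) : exJet s ∈ J3 := by
  change (exJet s).2 MultiIdx.zero 1 < (exJet s).2 MultiIdx.zero 2
  rw [← taylor_self, ← taylor_self, taylor_exJet, exJet_fst]
  simp [exSec, quad]

/-- The parameter at which the differential is diagonal. -/
def exPt : Fin 6 → ℝ := ![0, 1, 0, 0, 0, 0]

theorem fderiv_onJet_exJet (i j : Fin 6) :
    fderiv ℝ (onJet (basicOp i)) (exJet exPt) (exDir j)
      = Matrix.diagonal ![1, 1, 1, -1, -1, -1] i j := by
  have h1 : HasDerivAt (fun t : ℝ => exJet (exPt + t • Pi.single j 1)) (exDir j) 0 := by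
    have e : (fun t : ℝ => exJet (exPt + t • Pi.single j 1))
        = fun t => exJet exPt + t • exDir j := by
      funext t
      simp [exJet, add_smul, Finset.sum_add_distrib, Pi.single_apply, add_assoc]
    rw [e]
    simpa using ((hasDerivAt_id (0 : ℝ)).smul_const (exDir j)).const_add (exJet exPt)
  have hd : HasFDerivAt (onJet (basicOp i)) (fderiv ℝ (onJet (basicOp i)) (exJet exPt))
      (exJet (exPt + (0 : ℝ) • Pi.single j 1)) := by
    simpa using ((contDiffAt_basicOp i (exJet_mem exPt)).differentiableAt (by simp)).hasFDerivAt
  have h2 := hd.comp_hasDerivAt (0 : ℝ) h1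
  simp only [Function.comp_def, onJet_exJet] at h2
  -- `exVal` has degree at most one in each parameter separately, so moving a single parameter gives
  -- an exactly affine function.
  have e : ∀ t : ℝ, exVal (exPt + t • Pi.single j 1) i
      = exVal exPt i + t * Matrix.diagonal ![1, 1, 1, -1, -1, -1] i j := by
    intro t
    fin_cases i <;> fin_cases j <;> simp [exVal, exPt]
  simp only [e] at h2
  refine h2.unique ?_
  simpa using ((hasDerivAt_id (0 : ℝ)).mul_const _).const_add (exVal exPt i)

/-! ### Independence on a dense set -/

section Analytic

variable {V : Type*} [NormedAddCommGroup V] [NormedSpace ℝ V] {U : Set V} {f g : V → ℝ}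

/-- Identity theorem: a point outside the closure would have a neighbourhood on which `f = 0`,
forcing `f = 0` on all of `U`. -/
theorem subset_closure_ne_zero (hU : IsOpen U) (hc : IsPreconnected U)
    (hf : ∀ x ∈ U, ContDiffAt ℝ ω f x) (h : ∃ x ∈ U, f x ≠ 0) :
    U ⊆ closure {x ∈ U | f x ≠ 0} := by
  intro x hx
  by_contra hcon
  have han : AnalyticOnNhd ℝ f U := fun y hy => (hf y hy).analyticAt
  have h0 : f =ᶠ[nhds x] 0 := by
    filter_upwards [hU.mem_nhds hx, isClosed_closure.isOpen_compl.mem_nhds hcon] with y hy hy'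
    by_contra hne
    exact hy' (subset_closure ⟨hy, hne⟩)
  obtain ⟨y, hy, hne⟩ := h
  exact hne (han.eqOn_zero_of_preconnected_of_eventuallyEq_zero hc hx h0 hy)

/-- The two witnesses may differ: near a nonzero of `g` there are nonzeros of `f`, by density. -/
theorem exists_mul_ne_zero (hU : IsOpen U) (hc : IsPreconnected U)
    (hf : ∀ x ∈ U, ContDiffAt ℝ ω f x) (hg : ∀ x ∈ U, ContDiffAt ℝ ω g x)
    (h : ∃ x ∈ U, f x ≠ 0) (h' : ∃ x ∈ U, g x ≠ 0) : ∃ x ∈ U, f x * g x ≠ 0 := by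
  obtain ⟨x, hx, hne⟩ := h'
  have h1 : ∀ᶠ y in nhds x, g y ≠ 0 := (hg x hx).continuousAt.eventually_ne hne
  obtain ⟨y, hy, hyU, hfy⟩ :=
    mem_closure_iff_nhds.1 (subset_closure_ne_zero hU hc hf h hx) _ h1
  exact ⟨y, hyU, mul_ne_zero hfy hy⟩

end Analytic

/-! ### From the six basic functions to the five invariants -/

/-- The invariants as functions of the values of the basic operators. -/
def invFun (k : Fin 5) (a : Fin 6 → ℝ) : ℝ :=
  ![a 1 / a 0, a 1 / a 2, (a 3 / |a 0| ^ (3 / 2 : ℝ)) ^ 2, (a 5 / |a 0| ^ (3 / 2 : ℝ)) ^ 2,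
    (a 4 / |a 0| ^ (3 / 2 : ℝ)) ^ 2] k

/-- The values of the basic operators, as functions on the jet space. -/
def basicFun (θ : JetCoord) : Fin 6 → ℝ := fun i => onJet (basicOp i) θ

theorem inv_eq_invFun (k : Fin 5) : inv k = fun θ => invFun k (basicFun θ) := by
  funext θ
  exact invOfEq_eq _ _ _

theorem contDiffAt_basicFun {θ : JetCoord} (hθ : θ ∈ J3) : ContDiffAt ℝ ω basicFun θ :=
  contDiffAt_pi.2 fun i => contDiffAt_basicOp i hθ

theorem contDiffAt_invFun (k : Fin 5) {a : Fin 6 → ℝ} (h0 : a 0 ≠ 0) (h2 : a 2 ≠ 0) :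
    ContDiffAt ℝ ∞ (invFun k) a := by
  have hc : ∀ i, ContDiffAt ℝ ∞ (fun a : Fin 6 → ℝ => a i) a := fun i => by fun_prop
  have hr : ContDiffAt ℝ ∞ (fun a : Fin 6 → ℝ => |a 0| ^ (3 / 2 : ℝ)) a :=
    ContDiffAt.rpow_const_of_ne (ContDiffAt.abs (hc 0) h0) (abs_ne_zero.2 h0)
  have hr0 : |a 0| ^ (3 / 2 : ℝ) ≠ 0 := (Real.rpow_pos_of_pos (abs_pos.2 h0) _).ne'
  fin_cases k
  · exact (hc 1).div (hc 0) h0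
  · exact (hc 1).div (hc 2) h2
  · exact ((hc 3).div hr hr0).pow 2
  · exact ((hc 5).div hr hr0).pow 2
  · exact ((hc 4).div hr hr0).pow 2

theorem contDiffAt_inv (k : Fin 5) {θ : JetCoord} (hθ : θ ∈ genericJ3) :
    ContDiffAt ℝ ∞ (inv k) θ := by
  rw [inv_eq_invFun]
  exact (contDiffAt_invFun k hθ.2.1 hθ.2.2).comp θ ((contDiffAt_basicFun hθ.1).of_le le_top)

theorem isOpen_genericJ3 : IsOpen genericJ3 := by
  refine isOpen_iff_mem_nhds.2 fun θ hθ => ?_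
  have h := fun i => (contDiffAt_basicOp i hθ.1).continuousAt
  filter_upwards [isOpen_J3.mem_nhds hθ.1, (h 0).eventually_ne hθ.2.1,
    (h 2).eventually_ne hθ.2.2] with θ' h1 h2 h3
  exact ⟨h1, h2, h3⟩

/-- The direction in which the `k`-th invariant is tested. -/
def testIdx : Fin 5 → Fin 6 := ![0, 2, 3, 5, 4]

/-- `Λ₂` and the three numerators each enter a single invariant, which gives the triangular shape.
`Λ₁`, the test variable of `l = 0`, enters four of them and is excluded. -/
theorem fderiv_invFun_of_ne {a : Fin 6 → ℝ} (h0 : a 0 ≠ 0) (h2 : a 2 ≠ 0) {k l : Fin 5}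
    (hkl : l ≠ k) (hl : l ≠ 0) : fderiv ℝ (invFun k) a (Pi.single (testIdx l) 1) = 0 := by
  have hd := ((contDiffAt_invFun k h0 h2).differentiableAt (by simp)).hasFDerivAt
  have h1 : HasDerivAt (fun t : ℝ => a + t • (Pi.single (testIdx l) 1 : Fin 6 → ℝ))
      (Pi.single (testIdx l) 1) 0 := by
    simpa using ((hasDerivAt_id (0 : ℝ)).smul_const _).const_add a
  have h3 := HasFDerivAt.comp_hasDerivAt (0 : ℝ) (by simpa using hd) h1
  have e : (invFun k ∘ fun t : ℝ => a + t • (Pi.single (testIdx l) 1 : Fin 6 → ℝ))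
      = fun _ => invFun k a := by
    funext t
    fin_cases k <;> fin_cases l <;> simp [invFun, testIdx] at hkl hl ⊢
  rw [e] at h3
  exact h3.unique (hasDerivAt_const _ _)

/-- The diagonal derivatives are `-Λ₁₂ / Λ²` for the quotients and `2 n / |Λ₁|³` for the squares
with numerator `n`, hence the need for all six values to be nonzero. -/
theorem fderiv_invFun_self {a : Fin 6 → ℝ} (h : ∀ i, a i ≠ 0) (k : Fin 5) :
    fderiv ℝ (invFun k) a (Pi.single (testIdx k) 1) ≠ 0 := by
  have hd := ((contDiffAt_invFun k (h 0) (h 2)).differentiableAt (by simp)).hasFDerivAt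
  have h1 : HasDerivAt (fun t : ℝ => a + t • (Pi.single (testIdx k) 1 : Fin 6 → ℝ))
      (Pi.single (testIdx k) 1) 0 := by
    simpa using ((hasDerivAt_id (0 : ℝ)).smul_const _).const_add a
  have h3 := HasFDerivAt.comp_hasDerivAt (0 : ℝ) (by simpa using hd) h1
  have hi := hasDerivAt_id (0 : ℝ)
  have hq : ∀ x y : ℝ, y ≠ 0 → HasDerivAt (fun t : ℝ => x / (y + t)) (-x / y ^ 2) 0 := by
    intro x y hy
    have := (hasDerivAt_const (0 : ℝ) x).div (hi.const_add y) (by simpa using hy)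
    exact this.congr_deriv (by simp)
  have hs : ∀ x c : ℝ, HasDerivAt (fun t : ℝ => ((x + t) / c) ^ 2) (2 * (x / c) * (1 / c)) 0 := by
    intro x c
    have := ((hi.const_add x).div_const c).pow 2
    exact this.congr_deriv (by simp)
  have hr0 : |a 0| ^ (3 / 2 : ℝ) ≠ 0 := (Real.rpow_pos_of_pos (abs_pos.2 (h 0)) _).ne'
  have hq0 : ∀ i j, -a i / a j ^ 2 ≠ 0 := fun i j =>
    div_ne_zero (neg_ne_zero.2 (h i)) (pow_ne_zero _ (h j))
  have hs0 : ∀ i, 2 * (a i / |a 0| ^ (3 / 2 : ℝ)) * (1 / |a 0| ^ (3 / 2 : ℝ)) ≠ 0 := fun i =>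
    mul_ne_zero (mul_ne_zero two_ne_zero (div_ne_zero (h i) hr0)) (one_div_ne_zero hr0)
  fin_cases k
  · rw [h3.unique ((hq (a 1) (a 0) (h 0)).congr_of_eventuallyEq
      (Filter.Eventually.of_forall fun t => by simp [invFun, testIdx]))]
    exact hq0 1 0
  · rw [h3.unique ((hq (a 1) (a 2) (h 2)).congr_of_eventuallyEq
      (Filter.Eventually.of_forall fun t => by simp [invFun, testIdx]))]
    exact hq0 1 2
  · rw [h3.unique ((hs (a 3) (|a 0| ^ (3 / 2 : ℝ))).congr_of_eventuallyEq
      (Filter.Eventually.of_forall fun t => by simp [invFun, testIdx]))]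
    exact hs0 3
  · rw [h3.unique ((hs (a 5) (|a 0| ^ (3 / 2 : ℝ))).congr_of_eventuallyEq
      (Filter.Eventually.of_forall fun t => by simp [invFun, testIdx]))]
    exact hs0 5
  · rw [h3.unique ((hs (a 4) (|a 0| ^ (3 / 2 : ℝ))).congr_of_eventuallyEq
      (Filter.Eventually.of_forall fun t => by simp [invFun, testIdx]))]
    exact hs0 4

/-- The derivatives of the basic functions in the directions `exDir`. -/
def jacobian (θ : JetCoord) : Matrix (Fin 6) (Fin 6) ℝ :=
  Matrix.of fun i j => fderiv ℝ (onJet (basicOp i)) θ (exDir j)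

/-- An invertible Jacobian makes `basicFun` a submersion, so each coordinate direction of `ℝ⁶` lifts
to some `w j`; the triangular block is then tested on these lifts. -/
theorem linearIndependent_fderiv_inv {θ : JetCoord} (hθ : θ ∈ J3) (h : ∀ i, basicFun θ i ≠ 0)
    (hdet : (jacobian θ).det ≠ 0) : LinearIndependent ℝ (fun k => fderiv ℝ (inv k) θ) := by
  have hd : ∀ i, DifferentiableAt ℝ (onJet (basicOp i)) θ := fun i =>
    (contDiffAt_basicOp i hθ).differentiableAt (by simp)
  have hB : HasFDerivAt basicFun
      (ContinuousLinearMap.pi fun i => fderiv ℝ (onJet (basicOp i)) θ) θ :=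
    hasFDerivAt_pi.2 fun i => (hd i).hasFDerivAt
  have hw : ∀ j, ∃ w : JetCoord, (ContinuousLinearMap.pi
      fun i => fderiv ℝ (onJet (basicOp i)) θ) w = Pi.single j 1 := by
    intro j
    -- The coefficients form the `j`-th column of the inverse Jacobian.
    refine ⟨∑ k, (jacobian θ)⁻¹ k j • exDir k, ?_⟩
    funext i
    have := congrFun (congrFun (Matrix.mul_nonsing_inv (jacobian θ) hdet.isUnit) i) j
    rw [Matrix.mul_apply] at this
    rw [map_sum, Finset.sum_apply, Pi.single_apply, ← Matrix.one_apply, ← this]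
    exact Finset.sum_congr rfl fun k _ => by simp [jacobian, mul_comm]
  choose w hw using hw
  have hI : ∀ k j, fderiv ℝ (inv k) θ (w j) = fderiv ℝ (invFun k) (basicFun θ) (Pi.single j 1) := by
    intro k j
    have h1 := ((contDiffAt_invFun k (h 0) (h 2)).differentiableAt (by simp)).hasFDerivAt.comp θ hB
    have h2 : inv k = invFun k ∘ basicFun := inv_eq_invFun k
    rw [h2, h1.fderiv, ContinuousLinearMap.comp_apply, hw]
  rw [Fintype.linearIndependent_iff]
  intro c hc
  have hc' : ∀ l, ∑ k, c k * fderiv ℝ (invFun k) (basicFun θ) (Pi.single (testIdx l) 1) = 0 := by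
    intro l
    have := congrArg (fun L : JetCoord →L[ℝ] ℝ => L (w (testIdx l))) hc
    simpa [hI] using this
  -- Back substitution: the directions `l ≠ 0` isolate `c l`, after which the direction of `Λ₁`
  -- leaves only `c 0`.
  have hne : ∀ l, l ≠ 0 → c l = 0 := by
    intro l hl
    have := hc' l
    rw [Finset.sum_eq_single l (fun k _ hk => by
      rw [fderiv_invFun_of_ne (h 0) (h 2) hk.symm hl, mul_zero]) (by simp)] at this
    exact (mul_eq_zero.1 this).resolve_right (fderiv_invFun_self h l)
  intro l
  by_cases hl : l = 0
  · subst hl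
    have := hc' 0
    rw [Finset.sum_eq_single 0 (fun k _ hk => by rw [hne k hk, zero_mul]) (by simp)] at this
    exact (mul_eq_zero.1 this).resolve_right (fderiv_invFun_self h 0)
  · exact hne l hl

/-- A function whose zeros contain all jets at which the invariants are dependent. -/
def nondeg (θ : JetCoord) : ℝ := (∏ i, basicFun θ i) * (jacobian θ).det

theorem contDiffAt_prod_basicFun {θ : JetCoord} (hθ : θ ∈ J3) :
    ContDiffAt ℝ ω (fun θ => ∏ i, basicFun θ i) θ :=
  contDiffAt_prod fun i _ => contDiffAt_basicOp i hθ

theorem contDiffAt_det_jacobian {θ : JetCoord} (hθ : θ ∈ J3) :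
    ContDiffAt ℝ ω (fun θ => (jacobian θ).det) θ :=
  contDiff_det_of fun i _ =>
    ((contDiffAt_basicOp i hθ).fderiv_right (m := ω) (by simp)).clm_apply contDiffAt_const

/-- The jet with all parameters `1` serves the product and `exPt` serves the determinant; neither is
asked to serve both. -/
theorem exists_nondeg_ne_zero : ∃ θ ∈ J3, nondeg θ ≠ 0 := by
  refine exists_mul_ne_zero isOpen_J3 convex_J3.isPreconnected
    (fun _ => contDiffAt_prod_basicFun) (fun _ => contDiffAt_det_jacobian)
    ⟨exJet fun _ => 1, exJet_mem _, ?_⟩ ⟨exJet exPt, exJet_mem _, ?_⟩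
  · simp only [basicFun, onJet_exJet]
    refine Finset.prod_ne_zero_iff.2 fun i _ => ?_
    fin_cases i <;> norm_num [exVal]
  · have : jacobian (exJet exPt) = Matrix.diagonal ![1, 1, 1, -1, -1, -1] := by
      ext i j
      exact fderiv_onJet_exJet i j
    rw [this, Matrix.det_diagonal]
    simp [Fin.prod_univ_succ]

theorem contDiffAt_nondeg {θ : JetCoord} (hθ : θ ∈ J3) : ContDiffAt ℝ ω nondeg θ :=
  (contDiffAt_prod_basicFun hθ).mul (contDiffAt_det_jacobian hθ)

theorem J3_subset_closure_nondeg : J3 ⊆ closure {θ ∈ J3 | nondeg θ ≠ 0} :=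
  subset_closure_ne_zero isOpen_J3 convex_J3.isPreconnected (fun _ => contDiffAt_nondeg)
    exists_nondeg_ne_zero

theorem basicFun_ne_zero {θ : JetCoord} (h : nondeg θ ≠ 0) (i : Fin 6) : basicFun θ i ≠ 0 :=
  Finset.prod_ne_zero_iff.1 (left_ne_zero_of_mul h) i (Finset.mem_univ i)

theorem nondeg_subset_genericJ3 : {θ ∈ J3 | nondeg θ ≠ 0} ⊆ genericJ3 := fun _ hθ =>
  ⟨hθ.1, basicFun_ne_zero hθ.2 0, basicFun_ne_zero hθ.2 2⟩

theorem functionallyIndependentOn_inv : FunctionallyIndependentOn inv genericJ3 := by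
  refine ⟨{θ ∈ J3 | nondeg θ ≠ 0}, nondeg_subset_genericJ3, ?_,
    fun θ hθ => J3_subset_closure_nondeg hθ.1, fun θ hθ => ⟨fun k => ?_, ?_⟩⟩
  · refine isOpen_iff_mem_nhds.2 fun θ hθ => ?_
    exact Filter.inter_mem (isOpen_J3.mem_nhds hθ.1)
      ((contDiffAt_nondeg hθ.1).continuousAt.eventually_ne hθ.2)
  · exact (contDiffAt_inv k (nondeg_subset_genericJ3 hθ)).differentiableAt (by simp)
  · exact linearIndependent_fderiv_inv hθ.1 (basicFun_ne_zero hθ.2) (right_ne_zero_of_mul hθ.2)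

end

end MongeAmpere

open MongeAmpere in
open scoped ContDiff in
theorem mainTheorem3 :
    -- the value on an equation at a point depends only on its third-order jet there
    (∀ (u : M → Fin 4 → ℝ) (x : M), ContDiffAt ℝ ∞ u x → u x 1 < u x 2 →
      ∀ k, invOfEq u k x = inv k (jet3 u x)) ∧
    -- the first two invariants are of second order
    (∀ k : Fin 5, k = 0 ∨ k = 1 → ∀ θ ∈ J3, ∀ θ' ∈ J3, θ.1 = θ'.1 →
      (∀ σ : MultiIdx, σ.order ≤ 2 → θ.2 σ = θ'.2 σ) → inv k θ = inv k θ') ∧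
    -- they are smooth on the set of generic jets, which is open and dense in the jet space
    IsOpen genericJ3 ∧ J3 ⊆ closure genericJ3 ∧
    (∀ k, ContDiffOn ℝ ∞ (inv k) genericJ3) ∧
    -- they are functionally independent
    FunctionallyIndependentOn inv genericJ3 :=
  ⟨fun _ _ hu h k => invOfEq_eq_inv_jet3 hu h k,
    fun k hk _ hθ _ hθ' h1 h2 => inv_eq_of_order_two k hk hθ hθ' h1 h2,
    isOpen_genericJ3, J3_subset_closure_nondeg.trans (closure_mono nondeg_subset_genericJ3),
    fun k _ hθ => (contDiffAt_inv k hθ).contDiffWithinAt, functionallyIndependentOn_inv⟩
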